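/- Let $U\subset\mathbb R^N$ be an open set with coordinates $u=(u^1,\dots,u^N)$, let $g^{ij}$, $b^{ij}_k$ be smooth functions on $U$ and $K$ a real constant, and consider the nonlocal bracket of hydrodynamic type $$\{I,J\}=\int \frac{\delta I}{\delta u^i(x)}\Big(g^{ij}(u)\frac{d}{dx}+b^{ij}_k(u)\,u^k_x+K\,u^i_x\Big(\frac{d}{dx}\Big)^{-1}u^j_x\Big)\frac{\delta J}{\delta u^j(x)}\,dx \qquad(1)$$ on local functionals $I=\int h(u,u_x,\dots,u^{(n)})\,dx$ of fields $u(x)\in U$ (smooth densities $h$ modulo total $x$-derivatives of such densities; summation over repeated indices). Assume that (1) is a Poisson bracket, i.e. it is skew-symmetric and satisfies the Jacobi identity; it may be degenerate. Put $U^i=\int u^i\,dx$ for $1\le i\le N$. The bracket is called Liouville (in the coordinates $u$) if $\{U^i,U^j\}=0$ for $1\le i,j\le N$. A smooth matrix function $\Phi^{ij}$ on $U$ is called a Liouville function of the bracket if $$b^{ij}_k=\frac{\partial\Phi^{ij}}{\partial u^k}-K\delta^i_k u^j,\qquad g^{ij}=\Phi^{ij}+\Phi^{ji}-K u^iu^j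 .$$ The bracket is called special Liouville with a nonzero constant symmetric matrix $(\eta_{ij})$ if $\{U^i,U^j\}=0$ for $1\le i,j\le N+1$, where $U^{N+1}=\int\eta_{ij}u^iu^j\,dx$, and special Liouville if this holds for some such matrix. Theorem. For every nonzero constant symmetric matrix $(\eta_{ij})$, the bracket (1) is special Liouville with $(\eta_{ij})$ if and only if it is Liouville and has a Liouville function $\Phi^{ij}$ such that $$\eta_{ks}\Phi^{sj}=\frac{\partial H^j}{\partial u^k}\qquad(1\le j,k\le N)$$ for some smooth functions $H^1,\dots,H^N$ on $U$. Consequently, the bracket (1) is special Liouville if and only if it is Liouville and has a Liouville function that satisfies this condition for some nonzero constant symmetric matrix $(\eta_{ij})$ and some smooth functions $H^j$. -/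

import Mathlib

open scoped ContDiff

/-- The jets `(u, u_x, u_xx, …)` of fields with `N` components: `J k i` is the value of the
`k`-th `x`-derivative of `u^i`. -/
abbrev Jet (N : ℕ) : Type := ℕ → Fin N → ℝ

/-- Differential functions (local densities) `f(u, u_x, …, u^(n))` over the coordinate domain `U`:
smooth functions of finitely many derivatives of the fields, with `u ∈ U`. -/
def IsDiffFun {N : ℕ} (U : Set (Fin N → ℝ)) (f : Jet N → ℝ) : Prop :=
  ∃ (n : ℕ) (F : (Fin (n + 1) → Fin N → ℝ) → ℝ),
    ContDiffOn ℝ ∞ F {p | p 0 ∈ U} ∧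
      ∀ J : Jet N, J 0 ∈ U → f J = F (fun k => J (k : ℕ))

/-- The partial derivative of `f` with respect to the jet coordinate `u^i_(k)`. -/
noncomputable def jetDeriv {N : ℕ} (k : ℕ) (i : Fin N) (f : Jet N → ℝ) : Jet N → ℝ :=
  fun J => deriv (fun t => f (Function.update J k (Function.update (J k) i t))) (J k i)

/-- The total derivative `d/dx`; the sum over `k` is finite for differential functions. -/
noncomputable def totalDeriv {N : ℕ} (f : Jet N → ℝ) : Jet N → ℝ :=
  fun J => ∑ᶠ k : ℕ, ∑ i : Fin N, jetDeriv k i f J * J (k + 1) i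

/-- The variational derivative `δI/δu^i = ∑_k (-d/dx)^k ∂h/∂u^i_(k)` of `I = ∫ h dx`. -/
noncomputable def varDeriv {N : ℕ} (i : Fin N) (h : Jet N → ℝ) : Jet N → ℝ :=
  fun J => ∑ᶠ k : ℕ, (-1 : ℝ) ^ k * (totalDeriv^[k] (jetDeriv k i h)) J

/-- The functional `∫ h dx` is zero, that is, its density `h` is a total `x`-derivative of a
differential function (functionals are densities modulo total derivatives). -/
def IntegralVanishes {N : ℕ} (U : Set (Fin N → ℝ)) (h : Jet N → ℝ) : Prop :=
  ∃ f : Jet N → ℝ, IsDiffFun U f ∧ ∀ J : Jet N, J 0 ∈ U → h J = totalDeriv f J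

/-- The coefficients of a nonlocal bracket of hydrodynamic type with the operator
`P^{ij} = g^{ij}(u) d/dx + b^{ij}_k(u) u^k_x + K u^i_x (d/dx)^{-1} u^j_x`;
here `b u i j k` is `b^{ij}_k(u)`. -/
structure NonlocalBracket (N : ℕ) (U : Set (Fin N → ℝ)) where
  g : (Fin N → ℝ) → Fin N → Fin N → ℝ
  b : (Fin N → ℝ) → Fin N → Fin N → Fin N → ℝ
  K : ℝ
  smooth_g : ∀ i j, ContDiffOn ℝ ∞ (fun u => g u i j) U
  smooth_b : ∀ i j k, ContDiffOn ℝ ∞ (fun u => b u i j k) U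

namespace NonlocalBracket

variable {N : ℕ} {U : Set (Fin N → ℝ)}

/-- The `i`-th component of `P ζ`, where `w` stands for `(d/dx)^{-1} (u^j_x ζ_j)`. -/
noncomputable def operator (B : NonlocalBracket N U) (ζ : Fin N → Jet N → ℝ) (w : Jet N → ℝ)
    (i : Fin N) : Jet N → ℝ :=
  fun J => ∑ j, (B.g (J 0) i j * totalDeriv (ζ j) J + (∑ k, B.b (J 0) i j k * J 1 k) * ζ j J)
    + B.K * J 1 i * w J

/-- The equality of functionals `{∫ h₁ dx, ∫ h₂ dx} = ∫ h dx`. The nonlocal term is well defined: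
`u^j_x δI/δu^j` is a total derivative for every functional `I`, so a primitive `w` exists for
`I = ∫ h₂ dx`, and the choice of `w` changes the density by a total derivative only. -/
def IsBracket (B : NonlocalBracket N U) (h₁ h₂ h : Jet N → ℝ) : Prop :=
  ∃ w : Jet N → ℝ, IsDiffFun U w ∧
    (∀ J : Jet N, J 0 ∈ U → totalDeriv w J = ∑ j, J 1 j * varDeriv j h₂ J) ∧
    IntegralVanishes U
      (fun J => (∑ i, varDeriv i h₁ J * B.operator (fun j => varDeriv j h₂) w i J) - h J)

/-- The bracket is a Poisson bracket: it is skew-symmetric and satisfies the Jacobi identity. -/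
structure IsPoisson (B : NonlocalBracket N U) : Prop where
  skew : ∀ h₁ h₂ k₁₂ k₂₁ : Jet N → ℝ,
    IsDiffFun U h₁ → IsDiffFun U h₂ → IsDiffFun U k₁₂ → IsDiffFun U k₂₁ →
    B.IsBracket h₁ h₂ k₁₂ → B.IsBracket h₂ h₁ k₂₁ →
    IntegralVanishes U (fun J => k₁₂ J + k₂₁ J)
  jacobi : ∀ h₁ h₂ h₃ k₁₂ k₂₃ k₃₁ m₁ m₂ m₃ : Jet N → ℝ,
    IsDiffFun U h₁ → IsDiffFun U h₂ → IsDiffFun U h₃ →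
    IsDiffFun U k₁₂ → IsDiffFun U k₂₃ → IsDiffFun U k₃₁ →
    IsDiffFun U m₁ → IsDiffFun U m₂ → IsDiffFun U m₃ →
    B.IsBracket h₁ h₂ k₁₂ → B.IsBracket k₁₂ h₃ m₃ →
    B.IsBracket h₂ h₃ k₂₃ → B.IsBracket k₂₃ h₁ m₁ →
    B.IsBracket h₃ h₁ k₃₁ → B.IsBracket k₃₁ h₂ m₂ →
    IntegralVanishes U (fun J => m₁ J + m₂ J + m₃ J)

/-- `{∫ h₁ dx, ∫ h₂ dx} = 0`. -/
def InInvolution (B : NonlocalBracket N U) (h₁ h₂ : Jet N → ℝ) : Prop :=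
  B.IsBracket h₁ h₂ (fun _ => 0)

/-- `{U^i, U^j} = 0` for all `i, j`, where `U^i = ∫ u^i dx`. -/
def IsLiouville (B : NonlocalBracket N U) : Prop :=
  ∀ i j : Fin N, B.InInvolution (fun J => J 0 i) (fun J => J 0 j)

/-- The densities `u^i` (at `some i`) and `η_{ij} u^i u^j` (at `none`). -/
def specialDensity (η : Matrix (Fin N) (Fin N) ℝ) : Option (Fin N) → Jet N → ℝ
  | some i => fun J => J 0 i
  | none => fun J => ∑ i, ∑ j, η i j * J 0 i * J 0 j

/-- The integrals of `u^i` and of `η_{ij} u^i u^j` are in involution. -/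
def IsSpecialLiouvilleWith (B : NonlocalBracket N U) (η : Matrix (Fin N) (Fin N) ℝ) : Prop :=
  ∀ p q : Option (Fin N), B.InInvolution (specialDensity η p) (specialDensity η q)

/-- Special Liouville: for some nonzero constant symmetric matrix `η`, the integrals of `u^i` and
of `η_{ij} u^i u^j` are in involution. -/
def IsSpecialLiouville (B : NonlocalBracket N U) : Prop :=
  ∃ η : Matrix (Fin N) (Fin N) ℝ, η ≠ 0 ∧ η.IsSymm ∧ B.IsSpecialLiouvilleWith η

/-- `Φ` is a Liouville function of the bracket: `b^{ij}_k = ∂_k Φ^{ij} - K δ^i_k u^j` and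
`g^{ij} = Φ^{ij} + Φ^{ji} - K u^i u^j` on `U`. -/
structure IsLiouvilleFunction (B : NonlocalBracket N U)
    (Φ : (Fin N → ℝ) → Fin N → Fin N → ℝ) : Prop where
  smooth : ∀ i j, ContDiffOn ℝ ∞ (fun u => Φ u i j) U
  b_eq : ∀ u ∈ U, ∀ i j k, B.b u i j k =
    fderiv ℝ (fun v => Φ v i j) u (Pi.single k 1) - B.K * (if i = k then 1 else 0) * u j
  g_eq : ∀ u ∈ U, ∀ i j, B.g u i j = Φ u i j + Φ u j i - B.K * u i * u j

end NonlocalBracket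

/-- There are smooth functions `H^j` on `U` with `η_{ks} Φ^{sj} = ∂_k H^j`. -/
def IsSpecialFor {N : ℕ} (U : Set (Fin N → ℝ)) (η : Matrix (Fin N) (Fin N) ℝ)
    (Φ : (Fin N → ℝ) → Fin N → Fin N → ℝ) : Prop :=
  ∃ H : (Fin N → ℝ) → Fin N → ℝ, (∀ j, ContDiffOn ℝ ∞ (fun u => H u j) U) ∧
    ∀ u ∈ U, ∀ k j, ∑ s, η k s * Φ u s j = fderiv ℝ (fun v => H v j) u (Pi.single k 1)

/-! All the functionals in involution have densities depending on `u` alone, so the density of each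
bracket is linear in `u_x`, apart from the primitive `w` in the nonlocal term. Restricting
primitives to jets of constant fields makes involution equivalent to a first order system on `U`:
there are functions `W`, `X` with `∂_k W = ∂_k ψ` and `∂_k X` equal to the coefficient of `u^k_x`.
The theorem is then a computation with gradients (`inInvolution_comp_zero_iff`).

The Poisson property enters through skew-symmetry, in the form `g^{ij} = g^{ji}` and `∂_k g^{ij} =
b^{ij}_k + b^{ji}_k` (`symm_and_partialDeriv_eq`). These identities are obtained by testing
skew-symmetry on `∫ (u^i_x)^2/2` and `∫ (u^m_xx)^2/2`. After integration by parts the defect is an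
explicit quadratic plus cubic differential polynomial with coefficients on `U`. It is a total
derivative, so its integral over every small loop vanishes, and trigonometric loops isolate the
coefficients.

For a Liouville bracket, `{U^i, U^j} = 0` integrates `b^{ij}_k + K δ^i_k u^j` to a potential. By the
skew-symmetry identities, `g^{ij}` differs from the required expression by a symmetric function with
zero gradient, and adding half of it to the potential gives a Liouville function.

Given a Liouville function, the derivative of `η_{is} u^s Φ^{ij}` is `η_{ks} Φ^{sj}` plus half the
coefficient of `{U^{N+1}, U^j}`, taken with `w = u^j`. Hence this bracket vanishes exactly when
`η_{ks} Φ^{sj}` is a gradient in `k`. The functions `H^j` also give explicit primitives for `{U^i,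
U^{N+1}}` and `{U^{N+1}, U^{N+1}}`. -/

section

/-! ### Jet derivatives and total derivatives in finitely many variables. -/

variable {N : ℕ} {U : Set (Fin N → ℝ)}

/-- The first `n + 1` levels of a jet. -/
def Jet.trunc (n : ℕ) (J : Jet N) : Fin (n + 1) → Fin N → ℝ := fun k => J k

theorem isOpen_jetDomain (hU : IsOpen U) (n : ℕ) :
    IsOpen {p : Fin (n + 1) → Fin N → ℝ | p 0 ∈ U} :=
  hU.preimage (continuous_apply 0)

theorem jetDeriv_eq_of_le {f : Jet N → ℝ} {n : ℕ} {F : (Fin (n + 1) → Fin N → ℝ) → ℝ}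
    (hU : IsOpen U) (hF : ContDiffOn ℝ ∞ F {p | p 0 ∈ U})
    (hf : ∀ J : Jet N, J 0 ∈ U → f J = F (J.trunc n)) (J : Jet N) (hJ : J 0 ∈ U)
    (k : Fin (n + 1)) (i : Fin N) :
    jetDeriv k i f J = fderiv ℝ F (J.trunc n) (Pi.single k (Pi.single i 1)) := by
  have hd : DifferentiableAt ℝ F (J.trunc n) :=
    (hF.contDiffAt ((isOpen_jetDomain hU n).mem_nhds hJ)).differentiableAt (by simp)
  set c : ℝ → Jet N := fun t => Function.update J k (Function.update (J k) i t) with hc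
  have hc0 : c (J k i) = J := by simp [hc]
  have hk : ∀ l : ℕ, HasDerivAt (fun t => c t l) (if l = k then Pi.single i 1 else 0) (J k i) := by
    intro l
    by_cases h : l = k
    · subst h
      simpa [hc] using hasDerivAt_update (J k) i (J k i)
    · simpa [hc, h] using hasDerivAt_const (J k i) (J l)
  have hT : HasDerivAt (fun t => (c t).trunc n) (Pi.single k (Pi.single i 1)) (J k i) := by
    refine hasDerivAt_pi.2 fun l => ?_
    have h : (Pi.single k (Pi.single i 1) : Fin (n + 1) → Fin N → ℝ) l =
        if (l : ℕ) = k then Pi.single i 1 else 0 := by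
      simp only [Pi.single_apply, Fin.val_inj]
    rw [h]
    exact hk l
  have hev : ∀ᶠ t in nhds (J k i), c t 0 ∈ U :=
    (hk 0).continuousAt.eventually_mem (hU.mem_nhds (by simpa [hc0] using hJ))
  have := HasFDerivAt.comp_hasDerivAt_of_eq (J k i) hd.hasFDerivAt hT (by rw [hc0])
  refine (this.congr_of_eventuallyEq ?_).deriv
  filter_upwards [hev] with t ht
  exact hf _ ht

theorem jetDeriv_eq_zero_of_lt {f : Jet N → ℝ} {n : ℕ} {F : (Fin (n + 1) → Fin N → ℝ) → ℝ}
    (hf : ∀ J : Jet N, J 0 ∈ U → f J = F (J.trunc n)) (J : Jet N) (hJ : J 0 ∈ U)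
    {k : ℕ} (hk : n < k) (i : Fin N) : jetDeriv k i f J = 0 := by
  have : (fun t => f (Function.update J k (Function.update (J k) i t))) =
      fun _ => F (J.trunc n) := by
    funext t
    rw [hf _ (by rwa [Function.update_of_ne (by omega)])]
    congr 1
    funext l
    have : (l : ℕ) ≠ k := by omega
    simp [Jet.trunc, this]
  rw [jetDeriv, this, deriv_const]

/-- Jet derivatives above the order `n` vanish, so the `finsum` defining `totalDeriv` is a genuine
finite sum, and the chain rule collapses it to one directional derivative. -/
theorem totalDeriv_eq_fderiv {f : Jet N → ℝ} {n : ℕ} {F : (Fin (n + 1) → Fin N → ℝ) → ℝ}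
    (hU : IsOpen U) (hF : ContDiffOn ℝ ∞ F {p | p 0 ∈ U})
    (hf : ∀ J : Jet N, J 0 ∈ U → f J = F (J.trunc n)) (J : Jet N) (hJ : J 0 ∈ U) :
    totalDeriv f J = fderiv ℝ F (J.trunc n) (fun k => J (k + 1)) := by
  have h1 : totalDeriv f J =
      ∑ k ∈ Finset.range (n + 1), ∑ i : Fin N, jetDeriv k i f J * J (k + 1) i := by
    refine finsum_eq_sum_of_support_subset _ fun k hk => ?_
    by_contra hlt
    have hlt : n < k := by simpa [Nat.lt_succ_iff] using hlt
    exact hk (by simp [jetDeriv_eq_zero_of_lt hf J hJ hlt])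
  have h2 : (fun k : Fin (n + 1) => J (k + 1)) =
      ∑ k : Fin (n + 1), ∑ i : Fin N, J (k + 1) i • Pi.single k (Pi.single i (1 : ℝ)) := by
    funext l j
    simp only [Finset.sum_apply, Pi.smul_apply, smul_eq_mul]
    rw [Finset.sum_eq_single l _ (by simp)]
    · simp [Pi.single_apply]
    · intro k _ hk
      simp [hk.symm]
  rw [h1, h2, Finset.sum_range]
  simp only [map_sum, map_smul, smul_eq_mul]
  refine Finset.sum_congr rfl fun k _ => Finset.sum_congr rfl fun i _ => ?_
  rw [jetDeriv_eq_of_le hU hF hf J hJ, mul_comm]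

/-- Chain rule along a curve of jets that is the prolongation of a curve to first order. -/
theorem IsDiffFun.hasDerivAt {f : Jet N → ℝ} (hf : IsDiffFun U f) (hU : IsOpen U)
    {c : ℝ → Jet N} {x : ℝ} (hc : ∀ k, HasDerivAt (fun t => c t k) (c x (k + 1)) x)
    (hx : c x 0 ∈ U) : HasDerivAt (fun t => f (c t)) (totalDeriv f (c x)) x := by
  obtain ⟨n, F, hF, hfF⟩ := hf
  have hd : DifferentiableAt ℝ F ((c x).trunc n) :=
    (hF.contDiffAt ((isOpen_jetDomain hU n).mem_nhds hx)).differentiableAt (by simp)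
  have hT : HasDerivAt (fun t => (c t).trunc n) (fun k : Fin (n + 1) => c x (k + 1)) x :=
    hasDerivAt_pi.2 fun l => hc l
  rw [totalDeriv_eq_fderiv hU hF hfF _ hx]
  refine (hd.hasFDerivAt.comp_hasDerivAt x hT).congr_of_eventuallyEq ?_
  filter_upwards [(hc 0).continuousAt.eventually_mem (hU.mem_nhds hx)] with t ht
  exact hfF _ ht

/-- The line through a jet in the direction of its shift. -/
def Jet.line (J : Jet N) (t : ℝ) : Jet N := fun k => J k + t • J (k + 1)

@[simp] theorem Jet.line_zero (J : Jet N) : J.line 0 = J := by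
  funext k; simp [Jet.line]

theorem Jet.hasDerivAt_line (J : Jet N) (k : ℕ) :
    HasDerivAt (fun t => J.line t k) (J (k + 1)) 0 := by
  simpa [Jet.line] using ((hasDerivAt_id (0 : ℝ)).smul_const (J (k + 1))).const_add (J k)

theorem Jet.hasDerivAt_line_apply (J : Jet N) (k : ℕ) (i : Fin N) :
    HasDerivAt (fun t => J.line t k i) (J (k + 1) i) 0 :=
  hasDerivAt_pi.1 (J.hasDerivAt_line k) i

/-- This turns `totalDeriv` into an ordinary derivative in one variable, so that its sum and product
rules follow from uniqueness of derivatives. -/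
theorem IsDiffFun.hasDerivAt_line {f : Jet N → ℝ} (hf : IsDiffFun U f) (hU : IsOpen U)
    {J : Jet N} (hJ : J 0 ∈ U) : HasDerivAt (fun t => f (J.line t)) (totalDeriv f J) 0 := by
  have := hf.hasDerivAt hU (c := J.line) (x := 0) (by simpa using J.hasDerivAt_line) (by simpa)
  simpa using this

/-! ### The algebra of differential functions and the rules for `d/dx`. -/

namespace IsDiffFun

variable {f g : Jet N → ℝ}

theorem exists_of_le (hf : IsDiffFun U f) : ∃ n₀, ∀ n, n₀ ≤ n →
    ∃ F : (Fin (n + 1) → Fin N → ℝ) → ℝ, ContDiffOn ℝ ∞ F {p | p 0 ∈ U} ∧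
      ∀ J : Jet N, J 0 ∈ U → f J = F (fun k => J (k : ℕ)) := by
  obtain ⟨n₀, F, hF, hfF⟩ := hf
  refine ⟨n₀, fun n hn => ⟨fun p => F (fun k => p (k.castLE (by omega))), ?_, ?_⟩⟩
  · refine hF.comp (ContDiff.contDiffOn (by fun_prop)) fun p hp => ?_
    simpa using hp
  · intro J hJ
    simp [hfF J hJ]

theorem add (hf : IsDiffFun U f) (hg : IsDiffFun U g) : IsDiffFun U (fun J => f J + g J) := by
  obtain ⟨n₁, h₁⟩ := hf.exists_of_le
  obtain ⟨n₂, h₂⟩ := hg.exists_of_le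
  obtain ⟨F, hF, hfF⟩ := h₁ _ (le_max_left n₁ n₂)
  obtain ⟨G, hG, hgG⟩ := h₂ _ (le_max_right n₁ n₂)
  exact ⟨_, fun p => F p + G p, hF.add hG, fun J hJ => by simp only [hfF J hJ, hgG J hJ]⟩

theorem mul (hf : IsDiffFun U f) (hg : IsDiffFun U g) : IsDiffFun U (fun J => f J * g J) := by
  obtain ⟨n₁, h₁⟩ := hf.exists_of_le
  obtain ⟨n₂, h₂⟩ := hg.exists_of_le
  obtain ⟨F, hF, hfF⟩ := h₁ _ (le_max_left n₁ n₂)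
  obtain ⟨G, hG, hgG⟩ := h₂ _ (le_max_right n₁ n₂)
  exact ⟨_, fun p => F p * G p, hF.mul hG, fun J hJ => by simp only [hfF J hJ, hgG J hJ]⟩

theorem const (c : ℝ) : IsDiffFun U (fun _ : Jet N => c) :=
  ⟨0, fun _ => c, contDiffOn_const, fun _ _ => rfl⟩

theorem neg (hf : IsDiffFun U f) : IsDiffFun U (fun J => -f J) := by
  simpa using (const (-1)).mul hf

theorem sub (hf : IsDiffFun U f) (hg : IsDiffFun U g) : IsDiffFun U (fun J => f J - g J) := by
  simpa [sub_eq_add_neg] using hf.add hg.neg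

theorem sum {ι : Type*} (s : Finset ι) {f : ι → Jet N → ℝ} (hf : ∀ i ∈ s, IsDiffFun U (f i)) :
    IsDiffFun U (fun J => ∑ i ∈ s, f i J) := by
  classical
  induction s using Finset.induction_on with
  | empty => simpa using const 0
  | insert a s ha ih =>
    simpa [Finset.sum_insert ha] using
      (hf a (by simp)).add (ih fun i hi => hf i (by simp [hi]))

theorem coord (k : ℕ) (i : Fin N) : IsDiffFun U (fun J => J k i) :=
  ⟨k, fun p => p (Fin.last k) i, ContDiff.contDiffOn (by fun_prop), fun J _ => by simp⟩

theorem comp_zero {φ : (Fin N → ℝ) → ℝ} (hφ : ContDiffOn ℝ ∞ φ U) :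
    IsDiffFun U (fun J : Jet N => φ (J 0)) :=
  ⟨0, fun p => φ (p 0), hφ.comp (ContDiff.contDiffOn (by fun_prop)) fun _ hp => hp,
    fun J _ => by simp⟩

end IsDiffFun

section TotalDeriv

variable {f g : Jet N → ℝ}

theorem totalDeriv_add (hU : IsOpen U) (hf : IsDiffFun U f) (hg : IsDiffFun U g) {J : Jet N}
    (hJ : J 0 ∈ U) : totalDeriv (fun J => f J + g J) J = totalDeriv f J + totalDeriv g J :=
  ((hf.add hg).hasDerivAt_line hU hJ).unique ((hf.hasDerivAt_line hU hJ).add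
    (hg.hasDerivAt_line hU hJ))

theorem totalDeriv_sub (hU : IsOpen U) (hf : IsDiffFun U f) (hg : IsDiffFun U g) {J : Jet N}
    (hJ : J 0 ∈ U) : totalDeriv (fun J => f J - g J) J = totalDeriv f J - totalDeriv g J :=
  ((hf.sub hg).hasDerivAt_line hU hJ).unique ((hf.hasDerivAt_line hU hJ).sub
    (hg.hasDerivAt_line hU hJ))

theorem totalDeriv_mul (hU : IsOpen U) (hf : IsDiffFun U f) (hg : IsDiffFun U g) {J : Jet N}
    (hJ : J 0 ∈ U) :
    totalDeriv (fun J => f J * g J) J = totalDeriv f J * g J + f J * totalDeriv g J := by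
  simpa using ((hf.mul hg).hasDerivAt_line hU hJ).unique ((hf.hasDerivAt_line hU hJ).mul
    (hg.hasDerivAt_line hU hJ))

theorem totalDeriv_comp_zero (hU : IsOpen U) {φ : (Fin N → ℝ) → ℝ} (hφ : ContDiffOn ℝ ∞ φ U)
    {J : Jet N} (hJ : J 0 ∈ U) :
    totalDeriv (fun J => φ (J 0)) J = fderiv ℝ φ (J 0) (J 1) := by
  have hd : DifferentiableAt ℝ φ (J 0) :=
    (hφ.contDiffAt (hU.mem_nhds hJ)).differentiableAt (by simp)
  exact ((IsDiffFun.comp_zero hφ).hasDerivAt_line hU hJ).unique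
    (hd.hasFDerivAt.comp_hasDerivAt_of_eq 0 (J.hasDerivAt_line 0) (by simp))

theorem totalDeriv_const (c : ℝ) : totalDeriv (fun _ : Jet N => c) = fun _ => 0 := by
  funext J
  simp [totalDeriv, jetDeriv]

theorem totalDeriv_coord (k : ℕ) (i : Fin N) :
    totalDeriv (fun J : Jet N => J k i) = fun J => J (k + 1) i := by
  funext J
  simpa using ((IsDiffFun.coord (U := Set.univ) k i).hasDerivAt_line isOpen_univ
    (Set.mem_univ (J 0))).unique (J.hasDerivAt_line_apply k i)

end TotalDeriv

/-! ### Restriction to jets of constant fields. -/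

/-- The jet of the constant field `u`. -/
def constJet (u : Fin N → ℝ) : Jet N := fun k => if k = 0 then u else 0

@[simp] theorem constJet_zero (u : Fin N → ℝ) : constJet u 0 = u := rfl

theorem trunc_constJet (n : ℕ) :
    (fun u : Fin N → ℝ => (constJet u).trunc n) =
      ContinuousLinearMap.single ℝ (fun _ : Fin (n + 1) => Fin N → ℝ) 0 := by
  funext u l
  by_cases hl : l = 0
  · subst hl
    simp [Jet.trunc]
  · have : (l : ℕ) ≠ 0 := by simpa using hl
    simp [Jet.trunc, constJet, hl, this]

theorem IsDiffFun.contDiffOn_constJet {f : Jet N → ℝ} (hf : IsDiffFun U f) :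
    ContDiffOn ℝ ∞ (fun u => f (constJet u)) U := by
  obtain ⟨n, F, hF, hfF⟩ := hf
  have : ContDiff ℝ ∞ (fun u : Fin N → ℝ => (constJet u).trunc n) := by
    rw [trunc_constJet]
    exact ContinuousLinearMap.contDiff _
  refine (hF.comp this.contDiffOn fun u hu => ?_).congr fun u hu => hfF _ hu
  simpa [Jet.trunc] using hu

/-- If the total derivative of `f` is `∑ G_k u^k_x`, then `G` restricted to jets of constant
fields is the gradient of the restriction of `f`. -/
theorem fderiv_constJet_of_totalDeriv_eq (hU : IsOpen U) {f : Jet N → ℝ} (hf : IsDiffFun U f)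
    {G : Fin N → Jet N → ℝ} (hG : ∀ k, IsDiffFun U (G k))
    (h : ∀ J : Jet N, J 0 ∈ U → totalDeriv f J = ∑ k, G k J * J 1 k)
    {u : Fin N → ℝ} (hu : u ∈ U) (k : Fin N) :
    fderiv ℝ (fun v => f (constJet v)) u (Pi.single k 1) = G k (constJet u) := by
  classical
  set c : ℝ → Jet N := fun s l => if l = 0 then u else if l = 1 then Pi.single k s else 0 with hc
  have hc0 : c 0 = constJet u := by
    funext l
    rcases l with _ | _ | l <;> simp [hc, constJet]
  have hcc : ∀ l : ℕ, Continuous fun s => c s l := by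
    intro l
    rcases l with _ | _ | l
    · simpa [hc] using continuous_const
    · simpa [hc] using continuous_single (A := fun _ : Fin N => ℝ) k
    · simpa [hc] using continuous_const
  have hcu : ∀ s, c s 0 ∈ U := fun s => hu
  have hGc : ContinuousAt (fun s => G k (c s)) 0 := by
    obtain ⟨n, F, hF, hfF⟩ := hG k
    have h1 : ContinuousAt F ((c 0).trunc n) :=
      hF.continuousOn.continuousAt ((isOpen_jetDomain hU n).mem_nhds (hcu 0))
    have h2 : Continuous fun s => (c s).trunc n := continuous_pi fun l => hcc l
    have := ContinuousAt.comp (f := fun s => (c s).trunc n) h1 h2.continuousAt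
    exact this.congr (.of_forall fun s => (hfF _ (hcu s)).symm)
  obtain ⟨n, F, hF, hfF⟩ := hf
  have hFa : ∀ s, ContDiffAt ℝ ∞ F ((c s).trunc n) := fun s =>
    hF.contDiffAt ((isOpen_jetDomain hU n).mem_nhds (hcu s))
  set e : Fin (n + 1) → Fin N → ℝ := Pi.single 0 (Pi.single k 1) with he
  have hder : fderiv ℝ (fun v => f (constJet v)) u (Pi.single k 1) =
      fderiv ℝ F ((c 0).trunc n) e := by
    have hl : HasFDerivAt (fun v : Fin N → ℝ => (constJet v).trunc n)
        (ContinuousLinearMap.single ℝ (fun _ : Fin (n + 1) => Fin N → ℝ) 0) u := by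
      rw [trunc_constJet]
      exact ContinuousLinearMap.hasFDerivAt _
    have hF0 := ((hFa 0).differentiableAt (by simp)).hasFDerivAt
    rw [hc0] at hF0 ⊢
    have h1 := HasFDerivAt.comp u hF0 hl
    have h2 : HasFDerivAt (fun v => f (constJet v)) _ u := h1.congr_of_eventuallyEq (by
      filter_upwards [hU.mem_nhds hu] with v hv
      exact hfF _ hv)
    rw [h2.fderiv]
    simp [he]
  have hFc : ContinuousAt (fun s => fderiv ℝ F ((c s).trunc n) e) 0 := by
    have h1 : ContinuousAt (fderiv ℝ F) ((c 0).trunc n) :=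
      ((hFa 0).fderiv_right (m := 0) (by simp)).continuousAt
    have h2 : Continuous fun s => (c s).trunc n := continuous_pi fun l => hcc l
    exact (ContinuousAt.comp (f := fun s => (c s).trunc n) h1 h2.continuousAt).clm_apply
      continuousAt_const
  have heq : ∀ s ≠ 0, fderiv ℝ F ((c s).trunc n) e = G k (c s) := by
    intro s hs
    have h1 := h (c s) (hcu s)
    rw [totalDeriv_eq_fderiv hU hF hfF _ (hcu s)] at h1
    have h2 : (fun l : Fin (n + 1) => c s (l + 1)) = s • e := by
      funext l
      by_cases hl : l = 0
      · subst hl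
        funext j
        simp [hc, he, Pi.single_apply]
      · have : (l : ℕ) ≠ 0 := by simpa using hl
        simp [hc, he, hl, this]
    rw [h2, map_smul, smul_eq_mul, Finset.sum_eq_single k (fun j _ hj => by simp [hc, hj])
      (by simp)] at h1
    have h3 : c s 1 k = s := by simp [hc]
    rw [h3, mul_comm] at h1
    exact mul_right_cancel₀ hs h1
  rw [hder, ← hc0]
  refine tendsto_nhds_unique (hFc.tendsto.mono_left (nhdsWithin_le_nhds (s := {0}ᶜ))) ?_
  refine (hGc.tendsto.mono_left (nhdsWithin_le_nhds (s := {0}ᶜ))).congr' ?_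
  filter_upwards [self_mem_nhdsWithin] with s hs
  exact (heq s hs).symm

/-! ### Partial derivatives on `U`. -/

/-- The partial derivative with respect to the `k`-th coordinate. -/
noncomputable abbrev partialDeriv (k : Fin N) (φ : (Fin N → ℝ) → ℝ) (u : Fin N → ℝ) : ℝ :=
  fderiv ℝ φ u (Pi.single k 1)

theorem fderiv_eq_sum_partialDeriv (φ : (Fin N → ℝ) → ℝ) (u v : Fin N → ℝ) :
    fderiv ℝ φ u v = ∑ k, partialDeriv k φ u * v k := by
  have hv : v = ∑ k, v k • (Pi.single k 1 : Fin N → ℝ) := by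
    ext j
    simp [Pi.single_apply]
  conv_lhs => rw [hv]
  simp [mul_comm]

section Rules

variable {φ ψ : (Fin N → ℝ) → ℝ} {u : Fin N → ℝ} (k : Fin N)

theorem partialDeriv_add (hφ : DifferentiableAt ℝ φ u) (hψ : DifferentiableAt ℝ ψ u) :
    partialDeriv k (fun v => φ v + ψ v) u = partialDeriv k φ u + partialDeriv k ψ u := by
  simp [partialDeriv, fderiv_fun_add hφ hψ]

theorem partialDeriv_sub (hφ : DifferentiableAt ℝ φ u) (hψ : DifferentiableAt ℝ ψ u) :
    partialDeriv k (fun v => φ v - ψ v) u = partialDeriv k φ u - partialDeriv k ψ u := by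
  simp [partialDeriv, fderiv_fun_sub hφ hψ]

theorem partialDeriv_mul (hφ : DifferentiableAt ℝ φ u) (hψ : DifferentiableAt ℝ ψ u) :
    partialDeriv k (fun v => φ v * ψ v) u =
      partialDeriv k φ u * ψ u + φ u * partialDeriv k ψ u := by
  simp [partialDeriv, fderiv_fun_mul hφ hψ]
  ring

theorem partialDeriv_const_mul (c : ℝ) (hφ : DifferentiableAt ℝ φ u) :
    partialDeriv k (fun v => c * φ v) u = c * partialDeriv k φ u := by
  simp [partialDeriv, fderiv_const_mul hφ]

theorem partialDeriv_sum {ι : Type*} (s : Finset ι) {φ : ι → (Fin N → ℝ) → ℝ}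
    (hφ : ∀ i ∈ s, DifferentiableAt ℝ (φ i) u) :
    partialDeriv k (fun v => ∑ i ∈ s, φ i v) u = ∑ i ∈ s, partialDeriv k (φ i) u := by
  simp [partialDeriv, fderiv_fun_sum hφ]

theorem partialDeriv_const (c : ℝ) : partialDeriv k (fun _ : Fin N → ℝ => c) u = 0 := by
  simp [partialDeriv]

theorem partialDeriv_coord (i : Fin N) :
    partialDeriv k (fun v : Fin N → ℝ => v i) u = if i = k then 1 else 0 := by
  have : HasFDerivAt (fun v : Fin N → ℝ => v i) (ContinuousLinearMap.proj (R := ℝ) i) u :=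
    (ContinuousLinearMap.proj (R := ℝ) (φ := fun _ : Fin N => ℝ) i).hasFDerivAt
  simp [partialDeriv, this.fderiv, Pi.single_apply]

end Rules

theorem ContDiffOn.differentiableAt_of_isOpen {φ : (Fin N → ℝ) → ℝ} (hφ : ContDiffOn ℝ ∞ φ U)
    (hU : IsOpen U) {u : Fin N → ℝ} (hu : u ∈ U) : DifferentiableAt ℝ φ u :=
  (hφ.contDiffAt (hU.mem_nhds hu)).differentiableAt (by simp)

theorem totalDeriv_comp_zero_eq_sum (hU : IsOpen U) {φ : (Fin N → ℝ) → ℝ}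
    (hφ : ContDiffOn ℝ ∞ φ U) {J : Jet N} (hJ : J 0 ∈ U) :
    totalDeriv (fun J => φ (J 0)) J = ∑ k, partialDeriv k φ (J 0) * J 1 k := by
  rw [totalDeriv_comp_zero hU hφ hJ, fderiv_eq_sum_partialDeriv]

/-! ### Variational derivatives of the densities that occur. -/

/-- A density whose only nonzero jet derivatives with respect to `u^j` are those at level `n`. -/
theorem varDeriv_of_jetDeriv {h : Jet N → ℝ} {j : Fin N} (n : ℕ) {G : Jet N → ℝ}
    (hG : jetDeriv n j h = G) (h0 : ∀ k, k ≠ n → jetDeriv k j h = fun _ => 0) :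
    varDeriv j h = fun J => (-1) ^ n * (totalDeriv^[n] G) J := by
  funext J
  rw [varDeriv, finsum_eq_single _ n, hG]
  intro k hk
  have : ∀ m, (totalDeriv (N := N))^[m] (fun _ => 0) = fun _ => 0 := by
    intro m
    induction m with
    | zero => rfl
    | succ m ih => rw [Function.iterate_succ_apply', ih, totalDeriv_const]
  rw [h0 k hk, this, mul_zero]

theorem varDeriv_comp_zero {φ : (Fin N → ℝ) → ℝ} (hφ : Differentiable ℝ φ) (j : Fin N) :
    varDeriv j (fun J : Jet N => φ (J 0)) = fun J => partialDeriv j φ (J 0) := by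
  rw [varDeriv_of_jetDeriv (G := fun J => partialDeriv j φ (J 0)) 0]
  · simp
  · funext J
    have h := (hφ (J 0)).hasFDerivAt.comp_hasDerivAt_of_eq (J 0 j)
      (hasDerivAt_update (J 0) j (J 0 j)) (by simp)
    exact h.deriv
  · intro k hk
    funext J
    simp [jetDeriv, Function.update_of_ne hk.symm]

theorem varDeriv_sq (n : ℕ) (i j : Fin N) :
    varDeriv j (fun J : Jet N => J n i ^ 2 / 2) =
      fun J => if j = i then (-1) ^ n * J (n + n) i else 0 := by
  rw [varDeriv_of_jetDeriv (G := fun J => if j = i then J n i else 0) n]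
  · split_ifs with h
    · have : ∀ m, (totalDeriv (N := N))^[m] (fun J => J n i) = fun J => J (n + m) i := by
        intro m
        induction m with
        | zero => rfl
        | succ m ih => rw [Function.iterate_succ_apply', ih, totalDeriv_coord, add_assoc]
      simp [this]
    · have : ∀ m, (totalDeriv (N := N))^[m] (fun _ => 0) = fun _ => 0 := by
        intro m
        induction m with
        | zero => rfl
        | succ m ih => rw [Function.iterate_succ_apply', ih, totalDeriv_const]
      simp [this]
  · funext J
    by_cases h : j = i
    · subst h
      have h1 := (((hasDerivAt_id (J n j)).pow 2).div_const 2).deriv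
      simp [jetDeriv] at h1 ⊢
    · simp [jetDeriv, h, Function.update_of_ne (Ne.symm h)]
  · intro k hk
    funext J
    simp [jetDeriv, Function.update_of_ne hk.symm]

theorem integralVanishes_of_eq_zero {h : Jet N → ℝ} (hh : ∀ J : Jet N, J 0 ∈ U → h J = 0) :
    IntegralVanishes U h :=
  ⟨fun _ => 0, IsDiffFun.const 0, fun J hJ => by rw [hh J hJ, totalDeriv_const]⟩

/-! ### Involution of functionals without derivatives. -/

namespace NonlocalBracket

/-- The coefficient of `u^k_x` in the density of the bracket of `∫ φ(u) dx` and `∫ ψ(u) dx`,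
where `W` is the primitive used in the nonlocal term. -/
noncomputable def hydroCoeff (B : NonlocalBracket N U) (φ ψ W : (Fin N → ℝ) → ℝ) (k : Fin N)
    (u : Fin N → ℝ) : ℝ :=
  ∑ i, partialDeriv i φ u * (∑ j, (B.g u i j * partialDeriv k (partialDeriv j ψ) u +
    B.b u i j k * partialDeriv j ψ u)) + B.K * partialDeriv k φ u * W u

theorem contDiff_partialDeriv {ψ : (Fin N → ℝ) → ℝ} (hψ : ContDiff ℝ ∞ ψ) (j : Fin N) :
    ContDiff ℝ ∞ (partialDeriv j ψ) :=
  (hψ.fderiv_right (m := ∞) (by simp)).clm_apply contDiff_const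

theorem sum_varDeriv_mul_operator (B : NonlocalBracket N U) {φ ψ : (Fin N → ℝ) → ℝ}
    (hφ : ContDiff ℝ ∞ φ) (hψ : ContDiff ℝ ∞ ψ) (w : Jet N → ℝ) (J : Jet N) :
    ∑ i, varDeriv i (fun J => φ (J 0)) J *
      B.operator (fun j => varDeriv j fun J => ψ (J 0)) w i J =
    ∑ k, (∑ i, partialDeriv i φ (J 0) *
      (∑ j, (B.g (J 0) i j * partialDeriv k (partialDeriv j ψ) (J 0) +
        B.b (J 0) i j k * partialDeriv j ψ (J 0))) +
      B.K * partialDeriv k φ (J 0) * w J) * J 1 k := by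
  have hφd := hφ.differentiable (by simp)
  have hψd := hψ.differentiable (by simp)
  have ht : ∀ j, totalDeriv (fun J : Jet N => partialDeriv j ψ (J 0)) J =
      ∑ k, partialDeriv k (partialDeriv j ψ) (J 0) * J 1 k := fun j =>
    totalDeriv_comp_zero_eq_sum isOpen_univ (contDiff_partialDeriv hψ j).contDiffOn
      (Set.mem_univ _)
  simp only [operator, varDeriv_comp_zero hφd, varDeriv_comp_zero hψd, ht]
  simp only [Finset.mul_sum, Finset.sum_mul, mul_add, add_mul, Finset.sum_add_distrib]
  congr 1
  · congr 1
    · conv_rhs => rw [Finset.sum_comm]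
      refine Finset.sum_congr rfl fun i _ => ?_
      rw [Finset.sum_comm]
      exact Finset.sum_congr rfl fun k _ => Finset.sum_congr rfl fun j _ => by ring
    · conv_rhs => rw [Finset.sum_comm]
      refine Finset.sum_congr rfl fun i _ => ?_
      rw [Finset.sum_comm]
      exact Finset.sum_congr rfl fun k _ => Finset.sum_congr rfl fun j _ => by ring
  · exact Finset.sum_congr rfl fun k _ => by ring

/-- Involutivity of functionals of hydrodynamic type as a system of first order equations. -/
theorem inInvolution_comp_zero_iff (B : NonlocalBracket N U) (hU : IsOpen U)
    {φ ψ : (Fin N → ℝ) → ℝ} (hφ : ContDiff ℝ ∞ φ) (hψ : ContDiff ℝ ∞ ψ) :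
    B.InInvolution (fun J => φ (J 0)) (fun J => ψ (J 0)) ↔
      ∃ W X : (Fin N → ℝ) → ℝ, ContDiffOn ℝ ∞ W U ∧ ContDiffOn ℝ ∞ X U ∧
        ∀ u ∈ U, ∀ k, partialDeriv k W u = partialDeriv k ψ u ∧
          partialDeriv k X u = B.hydroCoeff φ ψ W k u := by
  have hψd := hψ.differentiable (by simp)
  have hsm : ∀ {χ : (Fin N → ℝ) → ℝ}, ContDiff ℝ ∞ χ → IsDiffFun U fun J => χ (J 0) :=
    fun h => IsDiffFun.comp_zero h.contDiffOn
  constructor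
  · rintro ⟨w, hw, hwt, f, hf, hft⟩
    -- Restricting the two primitives avoids having to prove that they depend on `u` alone.
    refine ⟨fun u => w (constJet u), fun u => f (constJet u), hw.contDiffOn_constJet,
      hf.contDiffOn_constJet, fun u hu k => ⟨?_, ?_⟩⟩
    · refine fderiv_constJet_of_totalDeriv_eq hU hw
        (G := fun j J => partialDeriv j ψ (J 0)) (fun j => hsm (contDiff_partialDeriv hψ j))
        (fun J hJ => ?_) hu k
      rw [hwt J hJ]
      simp only [varDeriv_comp_zero hψd, mul_comm]
    · refine fderiv_constJet_of_totalDeriv_eq hU hf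
        (G := fun k J => ∑ i, partialDeriv i φ (J 0) *
          (∑ j, (B.g (J 0) i j * partialDeriv k (partialDeriv j ψ) (J 0) +
            B.b (J 0) i j k * partialDeriv j ψ (J 0))) +
          B.K * partialDeriv k φ (J 0) * w J) (fun k => ?_) (fun J hJ => ?_) hu k
      · refine IsDiffFun.add (IsDiffFun.sum _ fun i _ => ?_)
          (((IsDiffFun.const _).mul (hsm (contDiff_partialDeriv hφ k))).mul hw)
        refine (hsm (contDiff_partialDeriv hφ i)).mul (IsDiffFun.sum _ fun j _ => ?_)
        exact ((IsDiffFun.comp_zero (B.smooth_g i j)).mul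
          (hsm (contDiff_partialDeriv (contDiff_partialDeriv hψ j) k))).add
          ((IsDiffFun.comp_zero (B.smooth_b i j k)).mul (hsm (contDiff_partialDeriv hψ j)))
      · rw [← hft J hJ]
        beta_reduce
        rw [sub_zero, B.sum_varDeriv_mul_operator hφ hψ]
  · rintro ⟨W, X, hW, hX, h⟩
    refine ⟨fun J => W (J 0), IsDiffFun.comp_zero hW, fun J hJ => ?_,
      fun J => X (J 0), IsDiffFun.comp_zero hX, fun J hJ => ?_⟩
    · rw [totalDeriv_comp_zero_eq_sum hU hW hJ]
      refine Finset.sum_congr rfl fun k _ => ?_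
      rw [(h _ hJ k).1, varDeriv_comp_zero hψd, mul_comm]
    · rw [totalDeriv_comp_zero_eq_sum hU hX hJ]
      beta_reduce
      rw [sub_zero, B.sum_varDeriv_mul_operator hφ hψ]
      refine Finset.sum_congr rfl fun k _ => ?_
      rw [(h _ hJ k).2, hydroCoeff]

end NonlocalBracket

/-! ### Coefficients of total derivatives, read off from integrals over small loops. -/

section Loops

open Real

/-- The integral depends continuously on the parameter. It serves to shrink a loop to its base point
after the leading power of its size has been divided out. -/
theorem intervalIntegral_eq_zero_of_forall_pos {a b δ : ℝ} (hδ : 0 < δ) {Ψ : ℝ → ℝ → ℝ}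
    (hΨ : ContinuousOn (Function.uncurry Ψ) (Set.Icc 0 δ ×ˢ Set.univ))
    (h : ∀ ε, 0 < ε → ε ≤ δ → ∫ x in a..b, Ψ ε x = 0) : ∫ x in a..b, Ψ 0 x = 0 := by
  -- Clamping `ε` to `[0, δ]` extends the integrand continuously to all parameters.
  set cl : ℝ → ℝ := fun ε => max 0 (min ε δ) with hcl
  have hcl0 : cl 0 = 0 := by simp [hcl, hδ.le]
  have hc : Continuous (Function.uncurry fun ε x => Ψ (cl ε) x) := by
    refine hΨ.comp_continuous (f := fun p : ℝ × ℝ => (cl p.1, p.2)) (by fun_prop) fun p => ?_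
    exact ⟨⟨le_max_left _ _, max_le hδ.le (min_le_right _ _)⟩, trivial⟩
  have hI : Continuous fun ε => ∫ x in a..b, Ψ (cl ε) x :=
    intervalIntegral.continuous_parametric_intervalIntegral_of_continuous' hc a b
  have h1 := (hI.tendsto 0).mono_left (nhdsWithin_le_nhds (s := Set.Ioi 0))
  rw [hcl0] at h1
  refine tendsto_nhds_unique h1 (tendsto_const_nhds.congr' ?_)
  filter_upwards [self_mem_nhdsWithin] with ε hε
  have hε : 0 < ε := hε
  rw [h _ (by simp [hε, hδ]) (max_le hδ.le (min_le_right _ _))]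

/-- The prolongations `p k` of a bounded loop with values in `ℝ^N`. -/
structure IsJetLoop (p : ℕ → ℝ → Fin N → ℝ) : Prop where
  hasDerivAt : ∀ k x, HasDerivAt (p k) (p (k + 1) x) x
  periodic : ∀ k, p k (2 * π) = p k 0
  bounded : ∃ M, ∀ x, ‖p 0 x‖ ≤ M

theorem IsJetLoop.exists_forall_mem {p : ℕ → ℝ → Fin N → ℝ} (hp : IsJetLoop p) (hU : IsOpen U)
    {u : Fin N → ℝ} (hu : u ∈ U) :
    ∃ δ : ℝ, 0 < δ ∧ ∀ ε, 0 ≤ ε → ε ≤ δ → ∀ x, u + ε • p 0 x ∈ U := by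
  obtain ⟨M, hM⟩ := hp.bounded
  obtain ⟨r, hr, hrU⟩ := Metric.isOpen_iff.1 hU u hu
  have hM0 : 0 ≤ M := (norm_nonneg _).trans (hM 0)
  refine ⟨r / (M + 1), by positivity, fun ε h0 hε x => hrU ?_⟩
  rw [Metric.mem_ball, dist_eq_norm, add_sub_cancel_left, norm_smul, Real.norm_of_nonneg h0]
  calc ε * ‖p 0 x‖ ≤ ε * M := by gcongr; exact hM x
    _ ≤ r / (M + 1) * M := by gcongr
    _ < r / (M + 1) * (M + 1) := by
      have : 0 < r / (M + 1) := by positivity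
      nlinarith
    _ = r := by field_simp

/-- The jet of the loop `u + ε p`. -/
def loopJet (u : Fin N → ℝ) (ε : ℝ) (p : ℕ → ℝ → Fin N → ℝ) (x : ℝ) : Jet N :=
  fun k => (if k = 0 then u else 0) + ε • p k x

/-- Along a jet loop the total derivative is the derivative of a function with equal values at `0`
and `2π`. -/
theorem IsJetLoop.integral_totalDeriv {p : ℕ → ℝ → Fin N → ℝ} (hp : IsJetLoop p)
    (hU : IsOpen U) {f : Jet N → ℝ} (hf : IsDiffFun U f) {u : Fin N → ℝ} {ε : ℝ}
    (hu : ∀ x, u + ε • p 0 x ∈ U) (hc : Continuous fun x => totalDeriv f (loopJet u ε p x)) :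
    ∫ x in (0 : ℝ)..2 * π, totalDeriv f (loopJet u ε p x) = 0 := by
  rw [intervalIntegral.integral_eq_sub_of_hasDerivAt
    (f := fun x => f (loopJet u ε p x)) (fun x _ => ?_) (hc.intervalIntegrable _ _)]
  · have : loopJet u ε p (2 * π) = loopJet u ε p 0 := by
      funext k
      simp [loopJet, hp.periodic]
    rw [this, sub_self]
  · refine hf.hasDerivAt hU (fun k => ?_) (by simpa [loopJet] using hu x)
    simpa [loopJet] using ((hp.hasDerivAt k x).const_smul ε).const_add (if k = 0 then u else 0)

theorem IsJetLoop.continuous_apply {p : ℕ → ℝ → Fin N → ℝ} (hp : IsJetLoop p) (k : ℕ)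
    (i : Fin N) : Continuous fun x => p k x i :=
  (_root_.continuous_apply i).comp
    (continuous_iff_continuousAt.2 fun x => (hp.hasDerivAt k x).continuousAt)

theorem IsJetLoop.continuous {p : ℕ → ℝ → Fin N → ℝ} (hp : IsJetLoop p) (k : ℕ) :
    Continuous (p k) :=
  continuous_iff_continuousAt.2 fun x => (hp.hasDerivAt k x).continuousAt

theorem ContinuousOn.uncurry_add_smul {c : (Fin N → ℝ) → ℝ} (hc : ContinuousOn c U)
    {q : ℝ → Fin N → ℝ} (hq : Continuous q) {u : Fin N → ℝ} {δ : ℝ}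
    (h : ∀ ε, 0 ≤ ε → ε ≤ δ → ∀ x, u + ε • q x ∈ U) :
    ContinuousOn (fun z : ℝ × ℝ => c (u + z.1 • q z.2)) (Set.Icc 0 δ ×ˢ Set.univ) :=
  hc.comp (Continuous.continuousOn (by fun_prop)) fun z hz => h _ hz.1.1 hz.1.2 _

section Cubic

variable {A : (Fin N → ℝ) → ℝ} {C : Fin N → (Fin N → ℝ) → ℝ} {i m : Fin N} {f : Jet N → ℝ}
  {p : ℕ → ℝ → Fin N → ℝ} {u : Fin N → ℝ}

/-- On the loop `u + ε p` the first term is of order `ε^2` and the sum of order `ε^3`. Dividing by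
`ε^2` and letting `ε → 0` leaves the quadratic term with coefficient frozen at `u`. -/
theorem integral_quadratic_eq_zero (hU : IsOpen U) (hf : IsDiffFun U f)
    (hA : ContinuousOn A U) (hC : ∀ k, ContinuousOn (C k) U)
    (h : ∀ J : Jet N, J 0 ∈ U → totalDeriv f J =
      A (J 0) * J 3 i * J 4 m - ∑ k, C k (J 0) * J 1 k * J 2 i * J 4 m)
    (hp : IsJetLoop p) (hu : u ∈ U) :
    ∫ x in (0 : ℝ)..2 * π, A u * p 3 x i * p 4 x m = 0 := by
  obtain ⟨δ, hδ, hδU⟩ := hp.exists_forall_mem hU hu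
  set Ψ : ℝ → ℝ → ℝ := fun ε x => A (u + ε • p 0 x) * p 3 x i * p 4 x m -
    ∑ k, C k (u + ε • p 0 x) * (ε * p 1 x k * p 2 x i * p 4 x m) with hΨdef
  have hpc := hp.continuous_apply
  have hpc0 := hp.continuous 0
  have hΨ : ContinuousOn (Function.uncurry Ψ) (Set.Icc 0 δ ×ˢ Set.univ) := by
    have h3 := hpc 3 i
    have h4 := hpc 4 m
    have h2 := hpc 2 i
    refine ContinuousOn.sub (((hA.uncurry_add_smul hpc0 hδU).mul ?_).mul ?_)
      (continuousOn_finsetSum _ fun k _ => ((hC k).uncurry_add_smul hpc0 hδU).mul ?_)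
    · exact (h3.comp continuous_snd).continuousOn
    · exact (h4.comp continuous_snd).continuousOn
    · have h1 := hpc 1 k
      exact Continuous.continuousOn (by fun_prop)
  have key : ∀ ε, 0 < ε → ε ≤ δ → ∫ x in (0 : ℝ)..2 * π, Ψ ε x = 0 := by
    intro ε h0 h1
    have hmem := hδU ε h0.le h1
    have heq : ∀ x, totalDeriv f (loopJet u ε p x) = ε ^ 2 * Ψ ε x := by
      intro x
      rw [h _ (by simpa [loopJet] using hmem x)]
      simp only [loopJet, hΨdef, mul_sub, Finset.mul_sum]
      simp only [if_true, Pi.add_apply, Pi.smul_apply, smul_eq_mul, OfNat.ofNat_ne_zero,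
        one_ne_zero, if_false, Pi.zero_apply, zero_add]
      congr 1
      · ring
      · exact Finset.sum_congr rfl fun k _ => by ring
    have hΨc : Continuous (Ψ ε) := by
      have := hΨ.comp_continuous (f := fun x : ℝ => (ε, x)) (by fun_prop)
        fun x => ⟨⟨h0.le, h1⟩, trivial⟩
      exact this
    have := hp.integral_totalDeriv hU hf hmem (by simp only [heq]; fun_prop)
    simp only [heq, intervalIntegral.integral_const_mul] at this
    exact (mul_eq_zero.1 this).resolve_left (by positivity)
  simpa [hΨdef] using intervalIntegral_eq_zero_of_forall_pos hδ hΨ key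

/-- The same scaling at order `ε^3`, available once the quadratic term is known to vanish. -/
theorem integral_cubic_eq_zero (hU : IsOpen U) (hf : IsDiffFun U f)
    (hC : ∀ k, ContinuousOn (C k) U)
    (h : ∀ J : Jet N, J 0 ∈ U → totalDeriv f J = - ∑ k, C k (J 0) * J 1 k * J 2 i * J 4 m)
    (hp : IsJetLoop p) (hu : u ∈ U) :
    ∫ x in (0 : ℝ)..2 * π, ∑ k, C k u * (p 1 x k * p 2 x i * p 4 x m) = 0 := by
  obtain ⟨δ, hδ, hδU⟩ := hp.exists_forall_mem hU hu
  set Ψ : ℝ → ℝ → ℝ := fun ε x =>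
    ∑ k, C k (u + ε • p 0 x) * (p 1 x k * p 2 x i * p 4 x m) with hΨdef
  have hpc := hp.continuous_apply
  have hpc0 := hp.continuous 0
  have hΨ : ContinuousOn (Function.uncurry Ψ) (Set.Icc 0 δ ×ˢ Set.univ) := by
    have h4 := hpc 4 m
    have h2 := hpc 2 i
    refine continuousOn_finsetSum _ fun k _ => ((hC k).uncurry_add_smul hpc0 hδU).mul ?_
    have h1 := hpc 1 k
    exact Continuous.continuousOn (by fun_prop)
  have key : ∀ ε, 0 < ε → ε ≤ δ → ∫ x in (0 : ℝ)..2 * π, Ψ ε x = 0 := by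
    intro ε h0 h1
    have hmem := hδU ε h0.le h1
    have heq : ∀ x, totalDeriv f (loopJet u ε p x) = -ε ^ 3 * Ψ ε x := by
      intro x
      rw [h _ (by simpa [loopJet] using hmem x)]
      simp only [loopJet, hΨdef, Finset.mul_sum, ← Finset.sum_neg_distrib]
      simp only [if_true, Pi.add_apply, Pi.smul_apply, smul_eq_mul, OfNat.ofNat_ne_zero,
        one_ne_zero, if_false, Pi.zero_apply, zero_add]
      exact Finset.sum_congr rfl fun k _ => by ring
    have hΨc : Continuous (Ψ ε) := by
      have := hΨ.comp_continuous (f := fun x : ℝ => (ε, x)) (by fun_prop)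
        fun x => ⟨⟨h0.le, h1⟩, trivial⟩
      exact this
    have := hp.integral_totalDeriv hU hf hmem (by simp only [heq]; fun_prop)
    simp only [heq, intervalIntegral.integral_const_mul] at this
    exact (mul_eq_zero.1 this).resolve_left (neg_ne_zero.2 (by positivity))
  simpa [hΨdef] using intervalIntegral_eq_zero_of_forall_pos hδ hΨ key

end Cubic

/-- The prolongations of the loop `α cos x + β sin x + γ sin 2x`. -/
noncomputable def trigLoop (α β γ : Fin N → ℝ) (k : ℕ) (x : ℝ) : Fin N → ℝ :=
  sin (x + (k + 1) * (π / 2)) • α + sin (x + k * (π / 2)) • β +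
    (2 ^ k * sin (2 * x + k * (π / 2))) • γ

theorem isJetLoop_trigLoop (α β γ : Fin N → ℝ) : IsJetLoop (trigLoop α β γ) where
  hasDerivAt k x := by
    -- Each derivative advances the phase by `π / 2`; this is how `trigLoop` encodes all
    -- prolongations in one formula.
    have hs : ∀ (a : ℝ), HasDerivAt (fun x => sin (x + a)) (sin (x + (a + π / 2))) x := by
      intro a
      have := (hasDerivAt_sin (x + a)).comp x ((hasDerivAt_id x).add_const a)
      rw [← add_assoc, sin_add_pi_div_two]
      simpa [Function.comp_def] using this
    have hs2 : ∀ (a : ℝ), HasDerivAt (fun x => sin (2 * x + a))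
        (2 * sin (2 * x + (a + π / 2))) x := by
      intro a
      have := (hasDerivAt_sin (2 * x + a)).comp x (((hasDerivAt_id x).const_mul 2).add_const a)
      rw [← add_assoc, sin_add_pi_div_two]
      simpa [Function.comp_def, mul_comm] using this
    have h1 := (hs ((k + 1) * (π / 2))).smul_const α
    have h2 := (hs (k * (π / 2))).smul_const β
    have h3 := ((hs2 (k * (π / 2))).const_mul (2 ^ k)).smul_const γ
    have := (h1.add h2).add h3
    refine this.congr_deriv ?_
    simp only [trigLoop, pow_succ, Nat.cast_add, Nat.cast_one, mul_assoc, add_mul, one_mul]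
  periodic k := by
    have hs : ∀ a : ℝ, sin (2 * π + a) = sin a := fun a => by rw [add_comm, sin_add_two_pi]
    have hs2 : ∀ a : ℝ, sin (2 * (2 * π) + a) = sin a := fun a => by
      rw [show 2 * (2 * π) + a = a + 2 * π + 2 * π by ring, sin_add_two_pi, sin_add_two_pi]
    simp [trigLoop, hs, hs2]
  bounded := by
    refine ⟨‖α‖ + ‖β‖ + ‖γ‖, fun x => ?_⟩
    have hs : ∀ (a : ℝ) (v : Fin N → ℝ), ‖sin a • v‖ ≤ ‖v‖ := fun a v => by
      rw [norm_smul]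
      exact mul_le_of_le_one_left (norm_nonneg _) (abs_sin_le_one a)
    unfold trigLoop
    refine (norm_add₃_le).trans ?_
    gcongr
    · exact hs _ _
    · exact hs _ _
    · simpa using hs (2 * x + (0 : ℕ) * (π / 2)) γ

theorem sin_add_nat_mul_pi_div_two (x : ℝ) :
    sin (x + 1 * (π / 2)) = cos x ∧ sin (x + 2 * (π / 2)) = -sin x ∧
      sin (x + 4 * (π / 2)) = sin x := by
  have h1 : ∀ y, sin (y + π / 2) = cos y := sin_add_pi_div_two
  have h2 : ∀ y, cos (y + π / 2) = -sin y := cos_add_pi_div_two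
  refine ⟨?_, ?_, ?_⟩
  · rw [one_mul, h1]
  · rw [show x + 2 * (π / 2) = x + π / 2 + π / 2 by ring, h1, h2]
  · rw [show x + 4 * (π / 2) = x + π / 2 + π / 2 + π / 2 + π / 2 by ring, h1, h2, h1, h2, neg_neg]

/-- What matters is that the value is nonzero. The factors are derivatives 1, 2 and 4 of `sin x +
sin 2x`; the second harmonic is needed because for `sin x` alone the integral is zero. -/
theorem integral_trig_cubic :
    ∫ x in (0 : ℝ)..2 * π, (cos x + 2 * cos (2 * x)) * (-sin x - 4 * sin (2 * x)) *
      (sin x + 16 * sin (2 * x)) = -(9 * π) := by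
  -- An explicit antiderivative: every term except `9 / 2 * x` vanishes at both endpoints.
  have hd : ∀ x ∈ Set.uIcc 0 (2 * π), HasDerivAt (fun x => -(337 / 3 * sin x ^ 3 -
      416 / 5 * sin x ^ 5 + 64 / 3 * sin (2 * x) ^ 3 + 9 / 2 * x -
      11 / 4 * (sin (2 * x) * cos (2 * x)) + 1 / 2 * sin (2 * x)))
      ((cos x + 2 * cos (2 * x)) * (-sin x - 4 * sin (2 * x)) * (sin x + 16 * sin (2 * x))) x := by
    intro x _
    have h2 : HasDerivAt (fun x : ℝ => 2 * x) 2 x := by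
      simpa using (hasDerivAt_id x).const_mul (2 : ℝ)
    have hs := hasDerivAt_sin x
    have hs2 := h2.sin
    have hc2 := h2.cos
    have := ((((((hs.pow 3).const_mul (337 / 3)).sub ((hs.pow 5).const_mul (416 / 5))).add
      ((hs2.pow 3).const_mul (64 / 3))).add ((hasDerivAt_id x).const_mul (9 / 2))).sub
      ((hs2.mul hc2).const_mul (11 / 4))).add (hs2.const_mul (1 / 2))
    refine this.neg.congr_deriv ?_
    simp only [sin_two_mul, cos_two_mul]
    push_cast
    have hS : sin x ^ 2 = 1 - cos x ^ 2 := by rw [← sin_sq_add_cos_sq x]; ring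
    have hS4 : sin x ^ 4 = (1 - cos x ^ 2) ^ 2 := by rw [← hS]; ring
    ring_nf
    simp only [hS, hS4]
    ring
  rw [intervalIntegral.integral_eq_sub_of_hasDerivAt hd
    (Continuous.intervalIntegrable (by fun_prop) _ _)]
  have h4 : sin (2 * (2 * π)) = 0 := by
    rw [show 2 * (2 * π) = (4 : ℕ) * π by push_cast; ring, sin_nat_mul_pi]
  simp [h4]
  ring

section Cubic

variable {A : (Fin N → ℝ) → ℝ} {C : Fin N → (Fin N → ℝ) → ℝ} {i m : Fin N} {f : Jet N → ℝ}
  {u : Fin N → ℝ}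

/-- With `cos x` in component `i` and `sin x` in component `m`, both `p 3 x i` and `p 4 x m` equal
`sin x`, and `∫ sin^2` is positive. For `i = m` no loop can work, since `p 3 x i * p 4 x i` is a
derivative. -/
theorem quadratic_coeff_eq_zero (hU : IsOpen U) (hf : IsDiffFun U f) (him : i ≠ m)
    (hA : ContinuousOn A U) (hC : ∀ k, ContinuousOn (C k) U)
    (h : ∀ J : Jet N, J 0 ∈ U → totalDeriv f J =
      A (J 0) * J 3 i * J 4 m - ∑ k, C k (J 0) * J 1 k * J 2 i * J 4 m)
    (hu : u ∈ U) : A u = 0 := by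
  have := integral_quadratic_eq_zero hU hf hA hC h
    (isJetLoop_trigLoop (Pi.single i 1) (Pi.single m 1) 0) hu
  have hI : ∀ x, A u * trigLoop (Pi.single i 1) (Pi.single m 1) 0 3 x i *
      trigLoop (Pi.single i 1) (Pi.single m 1) 0 4 x m = A u * sin x ^ 2 := by
    intro x
    obtain ⟨-, -, h4⟩ := sin_add_nat_mul_pi_div_two x
    have h4' : sin (x + (3 + 1) * (π / 2)) = sin x := by
      rw [← h4]; norm_num
    simp [trigLoop, him, him.symm, h4, h4']
    ring
  simp only [hI, intervalIntegral.integral_const_mul, integral_sin_sq] at this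
  simpa [pi_ne_zero] using this

/-- The loop `(sin x + sin 2x) a` gives `(∑ C_k a_k) a_i a_m = 0`. Comparing the vectors `(1, …, 1)`
and `(1, …, 1) + e_k`, which have no zero entry, isolates `C_k`. -/
theorem cubic_coeff_eq_zero (hU : IsOpen U) (hf : IsDiffFun U f)
    (hC : ∀ k, ContinuousOn (C k) U)
    (h : ∀ J : Jet N, J 0 ∈ U → totalDeriv f J = - ∑ k, C k (J 0) * J 1 k * J 2 i * J 4 m)
    (hu : u ∈ U) (k : Fin N) : C k u = 0 := by
  have key : ∀ a : Fin N → ℝ, a i ≠ 0 → a m ≠ 0 → ∑ k, C k u * a k = 0 := by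
    intro a hi hm
    have := integral_cubic_eq_zero hU hf hC h (isJetLoop_trigLoop 0 a a) hu
    have hI : ∀ x, ∑ k, C k u * (trigLoop 0 a a 1 x k * trigLoop 0 a a 2 x i *
        trigLoop 0 a a 4 x m) = (∑ k, C k u * a k) * (a i * a m) *
          ((cos x + 2 * cos (2 * x)) * (-sin x - 4 * sin (2 * x)) *
            (sin x + 16 * sin (2 * x))) := by
      intro x
      obtain ⟨h1, h2, h4⟩ := sin_add_nat_mul_pi_div_two x
      obtain ⟨h1', h2', h4'⟩ := sin_add_nat_mul_pi_div_two (2 * x)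
      rw [Finset.sum_mul, Finset.sum_mul]
      refine Finset.sum_congr rfl fun k _ => ?_
      simp only [trigLoop, Pi.add_apply, Pi.smul_apply, smul_eq_mul, Pi.zero_apply,
        Nat.cast_ofNat, Nat.cast_one, h1, h2, h4, h1', h2', h4']
      ring
    simp only [hI, intervalIntegral.integral_const_mul, integral_trig_cubic] at this
    simpa [pi_ne_zero, hi, hm] using this
  have h1 := key 1 (by simp) (by simp)
  have hpos : ∀ l, (1 + Pi.single k 1 : Fin N → ℝ) l ≠ 0 := by
    intro l
    by_cases hl : l = k
    · subst hl; norm_num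
    · simp [hl]
  have h2 := key (1 + Pi.single k 1) (hpos i) (hpos m)
  simp only [Pi.add_apply, mul_add, Finset.sum_add_distrib] at h2
  rw [h1] at h2
  simpa [Pi.single_apply] using h2

end Cubic

end Loops

/-! ### Skew-symmetry as conditions on `g` and `b`. -/

namespace NonlocalBracket

variable (B : NonlocalBracket N U)

theorem sum_varDeriv_sq_mul_operator (n l : ℕ) (i m : Fin N) (w : Jet N → ℝ) (J : Jet N) :
    ∑ j, varDeriv j (fun J => J n i ^ 2 / 2) J *
      B.operator (fun j => varDeriv j fun J => J l m ^ 2 / 2) w j J =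
    (-1) ^ n * J (n + n) i * (B.g (J 0) i m * ((-1) ^ l * J (l + l + 1) m) +
      (∑ k, B.b (J 0) i m k * J 1 k) * ((-1) ^ l * J (l + l) m) + B.K * J 1 i * w J) := by
  have ht : ∀ j, totalDeriv (fun J : Jet N => if j = m then (-1) ^ l * J (l + l) m else 0) J =
      if j = m then (-1) ^ l * J (l + l + 1) m else 0 := by
    intro j
    split_ifs
    · rw [totalDeriv_mul isOpen_univ (IsDiffFun.const _) (IsDiffFun.coord _ _) (Set.mem_univ _),
        totalDeriv_const, totalDeriv_coord]
      ring
    · rw [totalDeriv_const]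
  simp only [operator, varDeriv_sq, ht]
  simp [Finset.sum_add_distrib]

/-- The density of the skew-symmetry defect on two quadratic functionals, up to a total
derivative. -/
theorem exists_totalDeriv_eq_skew_defect (hU : IsOpen U) (hB : B.IsPoisson) (i m : Fin N) :
    ∃ f : Jet N → ℝ, IsDiffFun U f ∧ ∀ J : Jet N, J 0 ∈ U → totalDeriv f J =
      (B.g (J 0) i m - B.g (J 0) m i) * J 3 i * J 4 m -
        ∑ k, (B.b (J 0) i m k + B.b (J 0) m i k -
          partialDeriv k (fun u => B.g u i m) (J 0)) * J 1 k * J 2 i * J 4 m := by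
  have hc : ∀ k (j : Fin N), IsDiffFun U (fun J => J k j) := fun k j => IsDiffFun.coord k j
  have hg : ∀ i j, IsDiffFun U (fun J => B.g (J 0) i j) := fun i j =>
    IsDiffFun.comp_zero (B.smooth_g i j)
  have hb : ∀ i j, IsDiffFun U (fun J => ∑ k, B.b (J 0) i j k * J 1 k) := fun i j =>
    IsDiffFun.sum _ fun k _ => (IsDiffFun.comp_zero (B.smooth_b i j k)).mul (hc 1 k)
  have hsq : ∀ k j, IsDiffFun U (fun J : Jet N => J k j ^ 2 / 2) := fun k j => by
    simpa [sq, div_eq_mul_inv] using ((hc k j).mul (hc k j)).mul (IsDiffFun.const 2⁻¹)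
  have hsqt : ∀ k j {J : Jet N}, totalDeriv (fun J : Jet N => J k j ^ 2 / 2) J =
      J k j * J (k + 1) j := by
    intro k j J
    have h1 : (fun J : Jet N => J k j ^ 2 / 2) = fun J => (J k j * J k j) * 2⁻¹ := by
      funext J; ring
    have hc' : IsDiffFun Set.univ (fun J : Jet N => J k j) := IsDiffFun.coord k j
    rw [h1, totalDeriv_mul isOpen_univ (hc'.mul hc') (IsDiffFun.const _) (Set.mem_univ _),
      totalDeriv_mul isOpen_univ hc' hc' (Set.mem_univ _), totalDeriv_const, totalDeriv_coord]
    ring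
  -- The primitives of `u^j_x δI/δu^j` for the two test functionals, whose variational derivatives
  -- are `-u^i_xx` and `u^m_xxxx`.
  set w₁ : Jet N → ℝ := fun J => 0 - J 1 i ^ 2 / 2 with hw₁
  set w₂ : Jet N → ℝ := fun J => J 1 m * J 3 m - J 2 m ^ 2 / 2 with hw₂
  have dw₁ : IsDiffFun U w₁ := (IsDiffFun.const 0).sub (hsq 1 i)
  have dw₂ : IsDiffFun U w₂ := ((hc 1 m).mul (hc 3 m)).sub (hsq 2 m)
  have tw₁ : ∀ J : Jet N, J 0 ∈ U → totalDeriv w₁ J = - (J 1 i * J 2 i) := by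
    intro J hJ
    rw [hw₁, totalDeriv_sub hU (IsDiffFun.const 0) (hsq 1 i) hJ, totalDeriv_const, hsqt]
    ring
  have tw₂ : ∀ J : Jet N, J 0 ∈ U → totalDeriv w₂ J = J 1 m * J 4 m := by
    intro J hJ
    rw [hw₂, totalDeriv_sub hU ((hc 1 m).mul (hc 3 m)) (hsq 2 m) hJ, hsqt,
      totalDeriv_mul hU (hc 1 m) (hc 3 m) hJ, totalDeriv_coord, totalDeriv_coord]
    ring
  set k₁ : Jet N → ℝ := fun J => (-1) * J 2 i * (B.g (J 0) i m * J 5 m +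
    (∑ k, B.b (J 0) i m k * J 1 k) * J 4 m + B.K * J 1 i * w₂ J) with hk₁
  set k₂ : Jet N → ℝ := fun J => J 4 m * (B.g (J 0) m i * ((-1) * J 3 i) +
    (∑ k, B.b (J 0) m i k * J 1 k) * ((-1) * J 2 i) + B.K * J 1 m * w₁ J) with hk₂
  have dk₁ : IsDiffFun U k₁ :=
    ((IsDiffFun.const _).mul (hc 2 i)).mul ((((hg i m).mul (hc 5 m)).add
      ((hb i m).mul (hc 4 m))).add (((IsDiffFun.const _).mul (hc 1 i)).mul dw₂))
  have dk₂ : IsDiffFun U k₂ :=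
    (hc 4 m).mul ((((hg m i).mul ((IsDiffFun.const _).mul (hc 3 i))).add
      ((hb m i).mul ((IsDiffFun.const _).mul (hc 2 i)))).add
      (((IsDiffFun.const _).mul (hc 1 m)).mul dw₁))
  have br₁ : B.IsBracket (fun J => J 1 i ^ 2 / 2) (fun J => J 2 m ^ 2 / 2) k₁ := by
    refine ⟨w₂, dw₂, fun J hJ => ?_, integralVanishes_of_eq_zero fun J hJ => ?_⟩
    · rw [tw₂ J hJ]
      simp [varDeriv_sq]
    · rw [sum_varDeriv_sq_mul_operator, hk₁]
      norm_num
  have br₂ : B.IsBracket (fun J => J 2 m ^ 2 / 2) (fun J => J 1 i ^ 2 / 2) k₂ := by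
    refine ⟨w₁, dw₁, fun J hJ => ?_, integralVanishes_of_eq_zero fun J hJ => ?_⟩
    · rw [tw₁ J hJ]
      simp [varDeriv_sq]
    · rw [sum_varDeriv_sq_mul_operator, hk₂]
      norm_num
  obtain ⟨f, hf, hft⟩ := hB.skew _ _ _ _ (hsq 1 i) (hsq 2 m) dk₁ dk₂ br₁ br₂
  have dg := ((hg i m).mul (hc 2 i)).mul (hc 4 m)
  have dw := (IsDiffFun.const B.K).mul (dw₁.mul dw₂)
  -- Adding `g^{im} u^i_(2) u^m_(4)` integrates the `u^m_(5)` term by parts. The two nonlocal terms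
  -- sum to `K (w₁' w₂ + w₁ w₂')`, which subtracting `K w₁ w₂` removes.
  refine ⟨_, (hf.add dg).sub dw, fun J hJ => ?_⟩
  rw [totalDeriv_sub hU (hf.add dg) dw hJ, totalDeriv_add hU hf dg hJ, ← hft J hJ,
    totalDeriv_mul hU ((hg i m).mul (hc 2 i)) (hc 4 m) hJ, totalDeriv_mul hU (hg i m) (hc 2 i) hJ,
    totalDeriv_mul hU (IsDiffFun.const B.K) (dw₁.mul dw₂) hJ, totalDeriv_mul hU dw₁ dw₂ hJ,
    totalDeriv_const, tw₁ J hJ, tw₂ J hJ, totalDeriv_coord, totalDeriv_coord,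
    totalDeriv_comp_zero_eq_sum hU (B.smooth_g i m) hJ]
  have hsum : ∑ k, (B.b (J 0) i m k + B.b (J 0) m i k -
      partialDeriv k (fun u => B.g u i m) (J 0)) * J 1 k * J 2 i * J 4 m =
      (∑ k, B.b (J 0) i m k * J 1 k + ∑ k, B.b (J 0) m i k * J 1 k -
        ∑ k, partialDeriv k (fun u => B.g u i m) (J 0) * J 1 k) * J 2 i * J 4 m := by
    rw [← Finset.sum_add_distrib, ← Finset.sum_sub_distrib, Finset.sum_mul, Finset.sum_mul]
    exact Finset.sum_congr rfl fun k _ => by ring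
  rw [hsum]
  simp only [hk₁, hk₂]
  ring

/-- Skew-symmetry of the bracket: `g` is symmetric and `∂_k g^{ij} = b^{ij}_k + b^{ji}_k`. -/
theorem symm_and_partialDeriv_eq (hU : IsOpen U) (hB : B.IsPoisson) {u : Fin N → ℝ}
    (hu : u ∈ U) (i m : Fin N) : B.g u i m = B.g u m i ∧
      ∀ k, partialDeriv k (fun u => B.g u i m) u = B.b u i m k + B.b u m i k := by
  obtain ⟨f, hf, hft⟩ := B.exists_totalDeriv_eq_skew_defect hU hB i m
  have hA : ContinuousOn (fun u => B.g u i m - B.g u m i) U :=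
    (B.smooth_g i m).continuousOn.sub (B.smooth_g m i).continuousOn
  have hC : ∀ k, ContinuousOn (fun u => B.b u i m k + B.b u m i k -
      partialDeriv k (fun u => B.g u i m) u) U := fun k =>
    ((B.smooth_b i m k).continuousOn.add (B.smooth_b m i k).continuousOn).sub
      (((B.smooth_g i m).continuousOn_fderiv_of_isOpen hU (by simp)).clm_apply
        continuousOn_const)
  have h1 : ∀ u ∈ U, B.g u i m - B.g u m i = 0 := by
    intro u hu
    by_cases him : i = m
    · subst him; exact sub_self _
    · exact quadratic_coeff_eq_zero hU hf him hA hC hft hu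
  refine ⟨sub_eq_zero.1 (h1 u hu), fun k => ?_⟩
  have := cubic_coeff_eq_zero hU hf hC (fun J hJ => by rw [hft J hJ, h1 _ hJ]; ring) hu k
  exact (sub_eq_zero.1 this).symm

end NonlocalBracket

/-! ### The quadratic density and its gradient. -/

/-- The linear form `η_{is} u^s`. -/
def etaForm (η : Matrix (Fin N) (Fin N) ℝ) (i : Fin N) (u : Fin N → ℝ) : ℝ :=
  ∑ s, η i s * u s

/-- The quadratic form `η_{ij} u^i u^j`. -/
def etaQuad (η : Matrix (Fin N) (Fin N) ℝ) (u : Fin N → ℝ) : ℝ :=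
  ∑ i, u i * etaForm η i u

section Eta

variable (η : Matrix (Fin N) (Fin N) ℝ)

theorem contDiff_etaForm (i : Fin N) : ContDiff ℝ ∞ (etaForm η i) := by
  unfold etaForm; fun_prop

theorem contDiff_etaQuad : ContDiff ℝ ∞ (etaQuad η) := by
  unfold etaQuad etaForm; fun_prop

theorem specialDensity_none :
    NonlocalBracket.specialDensity η none = fun J => etaQuad η (J 0) := by
  funext J
  simp only [NonlocalBracket.specialDensity, etaQuad, etaForm, Finset.mul_sum]
  exact Finset.sum_congr rfl fun i _ => Finset.sum_congr rfl fun j _ => by ring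

theorem partialDeriv_etaForm (i k : Fin N) :
    partialDeriv k (etaForm η i) = fun _ => η i k := by
  funext u
  have h : ∀ s ∈ Finset.univ, DifferentiableAt ℝ (fun v : Fin N → ℝ => η i s * v s) u :=
    fun s _ => by fun_prop
  unfold etaForm
  rw [partialDeriv_sum k _ h]
  have h2 : ∀ s, partialDeriv k (fun v : Fin N → ℝ => η i s * v s) u =
      η i s * if s = k then 1 else 0 := fun s => by
    rw [partialDeriv_const_mul k _ (by fun_prop), partialDeriv_coord]
  simp [h2]

variable {η}

theorem partialDeriv_etaQuad (hη : η.IsSymm) (k : Fin N) :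
    partialDeriv k (etaQuad η) = fun u => 2 * etaForm η k u := by
  funext u
  have hd : ∀ i, DifferentiableAt ℝ (etaForm η i) u := fun i =>
    (contDiff_etaForm η i).differentiable (by simp) u
  unfold etaQuad
  have hd' : ∀ i ∈ Finset.univ, DifferentiableAt ℝ (fun v : Fin N → ℝ => v i * etaForm η i v) u :=
    fun i _ => DifferentiableAt.mul (by fun_prop) (hd i)
  rw [partialDeriv_sum k _ hd']
  have h2 : ∀ i, partialDeriv k (fun v : Fin N → ℝ => v i * etaForm η i v) u =
      (if i = k then 1 else 0) * etaForm η i u + u i * η i k := fun i => by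
    rw [partialDeriv_mul k (by fun_prop) (hd i), partialDeriv_coord, partialDeriv_etaForm]
  simp only [h2, Finset.sum_add_distrib, ite_mul, one_mul, zero_mul, Finset.sum_ite_eq',
    Finset.mem_univ, if_true]
  rw [two_mul]
  congr 1
  exact Finset.sum_congr rfl fun i _ => by rw [← hη.apply i k, mul_comm]

theorem partialDeriv_two_mul_etaForm (j k : Fin N) (u : Fin N → ℝ) :
    partialDeriv k (fun u => 2 * etaForm η j u) u = 2 * η j k := by
  rw [partialDeriv_const_mul k 2 ((contDiff_etaForm η j).differentiable (by simp) u),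
    partialDeriv_etaForm]

end Eta

theorem partialDeriv_coord_fun (i k : Fin N) :
    partialDeriv k (fun v : Fin N → ℝ => v i) = fun _ => if i = k then 1 else 0 := by
  funext u; exact partialDeriv_coord k i

/-! ### Bracket coefficients for linear and quadratic densities. -/

namespace NonlocalBracket

variable (B : NonlocalBracket N U)

theorem hydroCoeff_coord_coord (i j k : Fin N) (W : (Fin N → ℝ) → ℝ) (u : Fin N → ℝ) :
    B.hydroCoeff (fun v => v i) (fun v => v j) W k u =
      B.b u i j k + B.K * (if i = k then 1 else 0) * W u := by
  simp [hydroCoeff, partialDeriv_coord_fun, partialDeriv_const]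

theorem hydroCoeff_quad_coord {η : Matrix (Fin N) (Fin N) ℝ} (hη : η.IsSymm) (j k : Fin N)
    (W : (Fin N → ℝ) → ℝ) (u : Fin N → ℝ) :
    B.hydroCoeff (etaQuad η) (fun v => v j) W k u =
      2 * ∑ i, etaForm η i u * B.b u i j k + 2 * B.K * etaForm η k u * W u := by
  simp [hydroCoeff, partialDeriv_coord_fun, partialDeriv_etaQuad hη, partialDeriv_const,
    Finset.mul_sum, mul_assoc, mul_left_comm]

theorem hydroCoeff_coord_quad {η : Matrix (Fin N) (Fin N) ℝ} (hη : η.IsSymm) (i k : Fin N)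
    (W : (Fin N → ℝ) → ℝ) (u : Fin N → ℝ) :
    B.hydroCoeff (fun v => v i) (etaQuad η) W k u =
      2 * ∑ j, (B.g u i j * η j k + B.b u i j k * etaForm η j u) +
        B.K * (if i = k then 1 else 0) * W u := by
  simp only [hydroCoeff, partialDeriv_coord, partialDeriv_etaQuad hη,
    partialDeriv_two_mul_etaForm, ite_mul, one_mul, zero_mul, Finset.sum_ite_eq,
    Finset.mem_univ, if_true, congrFun (partialDeriv_etaQuad hη _) u]
  rw [Finset.mul_sum]
  congr 1
  exact Finset.sum_congr rfl fun j _ => by ring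

theorem hydroCoeff_quad_quad {η : Matrix (Fin N) (Fin N) ℝ} (hη : η.IsSymm) (k : Fin N)
    (W : (Fin N → ℝ) → ℝ) (u : Fin N → ℝ) :
    B.hydroCoeff (etaQuad η) (etaQuad η) W k u =
      4 * ∑ i, etaForm η i u * ∑ j, (B.g u i j * η j k + B.b u i j k * etaForm η j u) +
        2 * B.K * etaForm η k u * W u := by
  simp only [hydroCoeff, partialDeriv_etaQuad hη, partialDeriv_two_mul_etaForm, Finset.mul_sum,
    congrFun (partialDeriv_etaQuad hη _) u]
  congr 1
  · exact Finset.sum_congr rfl fun i _ => Finset.sum_congr rfl fun j _ => by ring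
  · ring

end NonlocalBracket

/-! ### Liouville functions and the gradient condition. -/

namespace NonlocalBracket

variable {B : NonlocalBracket N U}

theorem contDiff_coord (j : Fin N) : ContDiff ℝ ∞ (fun v : Fin N → ℝ => v j) := by fun_prop

theorem IsLiouville.exists_isLiouvilleFunction (hU : IsOpen U) (hB : B.IsPoisson)
    (h : B.IsLiouville) : ∃ Φ, B.IsLiouvilleFunction Φ := by
  have h' := fun i j => (B.inInvolution_comp_zero_iff hU (contDiff_coord i)
    (contDiff_coord j)).1 (h i j)
  choose W X hW hX hWX using h'
  -- `W i j` and `u^j` have the same gradient, but their difference need not vanish; the correction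
  -- term replaces `W i j` by `u^j` in the derivative of `X i j`.
  set Φ₀ : (Fin N → ℝ) → Fin N → Fin N → ℝ := fun u i j =>
    X i j u - B.K * ((W i j u - u j) * u i) with hΦ₀
  have hs₀ : ∀ i j, ContDiffOn ℝ ∞ (fun u => Φ₀ u i j) U := fun i j =>
    (hX i j).sub (contDiffOn_const.mul (((hW i j).sub (contDiff_coord j).contDiffOn).mul
      (contDiff_coord i).contDiffOn))
  have hd₀ : ∀ u ∈ U, ∀ i j k, partialDeriv k (fun v => Φ₀ v i j) u =
      B.b u i j k + B.K * (if i = k then 1 else 0) * u j := by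
    intro u hu i j k
    have dX := (hX i j).differentiableAt_of_isOpen hU hu
    have dW := (hW i j).differentiableAt_of_isOpen hU hu
    have dc : ∀ i : Fin N, DifferentiableAt ℝ (fun v : Fin N → ℝ => v i) u := fun i => by fun_prop
    obtain ⟨h1, h2⟩ := hWX i j u hu k
    rw [hydroCoeff_coord_coord] at h2
    have dWc : DifferentiableAt ℝ (fun v => W i j v - v j) u := dW.sub (dc j)
    have h3 : partialDeriv k (fun v => (W i j v - v j) * v i) u =
        (W i j u - u j) * if i = k then 1 else 0 := by
      rw [partialDeriv_mul k dWc (dc i), partialDeriv_sub k dW (dc j), h1,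
        partialDeriv_coord k i]
      ring
    have h4 : DifferentiableAt ℝ (fun v => (W i j v - v j) * v i) u := dWc.mul (dc i)
    simp only [hΦ₀]
    rw [partialDeriv_sub k dX (h4.const_mul _), partialDeriv_const_mul k _ h4, h2, h3]
    ring
  -- The defect in the formula for `g` has zero gradient. As `U` may be disconnected, it is kept as
  -- a function rather than replaced by a constant.
  set s : (Fin N → ℝ) → Fin N → Fin N → ℝ := fun u i j =>
    B.g u i j - (Φ₀ u i j + Φ₀ u j i - B.K * (u i * u j)) with hs
  have hss : ∀ i j, ContDiffOn ℝ ∞ (fun u => s u i j) U := fun i j =>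
    (B.smooth_g i j).sub (((hs₀ i j).add (hs₀ j i)).sub (contDiffOn_const.mul
      ((contDiff_coord i).contDiffOn.mul (contDiff_coord j).contDiffOn)))
  have hds : ∀ u ∈ U, ∀ i j k, partialDeriv k (fun v => s v i j) u = 0 := by
    intro u hu i j k
    have dg := (B.smooth_g i j).differentiableAt_of_isOpen hU hu
    have dΦ := fun i j => (hs₀ i j).differentiableAt_of_isOpen hU hu
    have dc : ∀ i : Fin N, DifferentiableAt ℝ (fun v : Fin N → ℝ => v i) u := fun i => by fun_prop
    have dm : DifferentiableAt ℝ (fun v : Fin N → ℝ => v i * v j) u := (dc i).mul (dc j)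
    have d1 : DifferentiableAt ℝ (fun v => Φ₀ v i j + Φ₀ v j i) u := (dΦ i j).add (dΦ j i)
    have d2 : DifferentiableAt ℝ (fun v => Φ₀ v i j + Φ₀ v j i - B.K * (v i * v j)) u :=
      d1.sub (dm.const_mul _)
    simp only [hs]
    rw [partialDeriv_sub k dg d2, partialDeriv_sub k d1 (dm.const_mul _),
      partialDeriv_add k (dΦ i j) (dΦ j i), partialDeriv_const_mul k _ dm,
      partialDeriv_mul k (dc i) (dc j), partialDeriv_coord, partialDeriv_coord,
      hd₀ u hu, hd₀ u hu, (B.symm_and_partialDeriv_eq hU hB hu i j).2 k]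
    ring
  -- Since `s` is symmetric in `i, j`, half of it enters `Φ^{ij} + Φ^{ji}` twice and repairs `g`,
  -- while `∂_k Φ^{ij}` is unaffected.
  refine ⟨fun u i j => Φ₀ u i j + 2⁻¹ * s u i j, fun i j => (hs₀ i j).add
    (contDiffOn_const.mul (hss i j)), fun u hu i j k => ?_, fun u hu i j => ?_⟩
  · have dΦ := (hs₀ i j).differentiableAt_of_isOpen hU hu
    have ds := (hss i j).differentiableAt_of_isOpen hU hu
    change _ = partialDeriv k (fun v => Φ₀ v i j + 2⁻¹ * s v i j) u - _
    rw [partialDeriv_add k dΦ (ds.const_mul 2⁻¹), partialDeriv_const_mul k _ ds, hds u hu, hd₀ u hu]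
    ring
  · have := (B.symm_and_partialDeriv_eq hU hB hu i j).1
    simp only [hs]
    rw [← this]
    ring

variable {η : Matrix (Fin N) (Fin N) ℝ} {Φ : (Fin N → ℝ) → Fin N → Fin N → ℝ}

theorem IsLiouvilleFunction.partialDeriv_eq (hΦ : B.IsLiouvilleFunction Φ) {u : Fin N → ℝ}
    (hu : u ∈ U) (i j k : Fin N) : partialDeriv k (fun v => Φ v i j) u =
      B.b u i j k + B.K * (if i = k then 1 else 0) * u j := by
  rw [hΦ.b_eq u hu]
  ring

theorem IsLiouvilleFunction.contDiffOn_contract (hΦ : B.IsLiouvilleFunction Φ) (j : Fin N) :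
    ContDiffOn ℝ ∞ (fun u => ∑ i, etaForm η i u * Φ u i j) U :=
  ContDiffOn.sum fun i _ => (contDiff_etaForm η i).contDiffOn.mul (hΦ.smooth i j)

/-- The derivatives of `η_{is} u^s Φ^{ij}`. -/
theorem IsLiouvilleFunction.partialDeriv_contract (hU : IsOpen U) (hη : η.IsSymm)
    (hΦ : B.IsLiouvilleFunction Φ) {u : Fin N → ℝ} (hu : u ∈ U) (j k : Fin N) :
    partialDeriv k (fun u => ∑ i, etaForm η i u * Φ u i j) u =
      ∑ s, η k s * Φ u s j + ∑ i, etaForm η i u * B.b u i j k +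
        B.K * etaForm η k u * u j := by
  have dΦ := fun i => (hΦ.smooth i j).differentiableAt_of_isOpen hU hu
  have dη : ∀ i, DifferentiableAt ℝ (etaForm η i) u := fun i =>
    (contDiff_etaForm η i).differentiable (by simp) u
  have dm : ∀ i ∈ Finset.univ, DifferentiableAt ℝ (fun v => etaForm η i v * Φ v i j) u :=
    fun i _ => (dη i).mul (dΦ i)
  have h : ∀ i, partialDeriv k (fun v => etaForm η i v * Φ v i j) u = η k i * Φ u i j +
      etaForm η i u * B.b u i j k + (if i = k then B.K * etaForm η i u * u j else 0) := by
    intro i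
    rw [partialDeriv_mul k (dη i) (dΦ i), partialDeriv_etaForm, hΦ.partialDeriv_eq hu,
      hη.apply i k]
    split_ifs <;> ring
  rw [partialDeriv_sum k _ dm]
  simp only [h, Finset.sum_add_distrib]
  simp

/-- Half the primitive of `{U^{N+1}, U^j}`, normalised to `w = u^j`, and `η_{is} u^s Φ^{ij}` have
gradients differing by `η_{ks} Φ^{sj}`, so their difference is `H^j`. The argument applies to any
Liouville function. -/
theorem IsLiouvilleFunction.isSpecialFor (hU : IsOpen U) (hη : η.IsSymm)
    (hΦ : B.IsLiouvilleFunction Φ) (h : B.IsSpecialLiouvilleWith η) : IsSpecialFor U η Φ := by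
  have h' : ∀ j, B.InInvolution (fun J => etaQuad η (J 0)) (fun J => J 0 j) := fun j => by
    rw [← specialDensity_none]
    exact h none (some j)
  have h'' := fun j => (B.inInvolution_comp_zero_iff hU (contDiff_etaQuad η)
    (contDiff_coord j)).1 (h' j)
  choose W X hW hX hWX using h''
  refine ⟨fun u j => (∑ i, etaForm η i u * Φ u i j) -
      2⁻¹ * (X j u - B.K * ((W j u - u j) * etaQuad η u)), fun j => ?_, fun u hu k j => ?_⟩
  · exact (hΦ.contDiffOn_contract j).sub (contDiffOn_const.mul ((hX j).sub (contDiffOn_const.mul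
      (((hW j).sub (contDiff_coord j).contDiffOn).mul (contDiff_etaQuad η).contDiffOn))))
  · have dX := (hX j).differentiableAt_of_isOpen hU hu
    have dW := (hW j).differentiableAt_of_isOpen hU hu
    have dc : DifferentiableAt ℝ (fun v : Fin N → ℝ => v j) u := by fun_prop
    have dQ := (contDiff_etaQuad η).differentiable (by simp) u
    have dWc : DifferentiableAt ℝ (fun v => W j v - v j) u := dW.sub dc
    have dm : DifferentiableAt ℝ (fun v => (W j v - v j) * etaQuad η v) u := dWc.mul dQ
    have d1 : DifferentiableAt ℝ (fun v => X j v - B.K * ((W j v - v j) * etaQuad η v)) u :=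
      dX.sub (dm.const_mul _)
    have d2 := (hΦ.contDiffOn_contract (η := η) j).differentiableAt_of_isOpen hU hu
    obtain ⟨h1, h2⟩ := hWX j u hu k
    rw [hydroCoeff_quad_coord B hη] at h2
    change _ = partialDeriv k (fun u => (∑ i, etaForm η i u * Φ u i j) -
      2⁻¹ * (X j u - B.K * ((W j u - u j) * etaQuad η u))) u
    rw [partialDeriv_sub k d2 (d1.const_mul 2⁻¹), hΦ.partialDeriv_contract hU hη hu, partialDeriv_const_mul k _ d1,
      partialDeriv_sub k dX (dm.const_mul _), partialDeriv_const_mul k _ dm,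
      partialDeriv_mul k dWc dQ, partialDeriv_sub k dW dc, h1, h2,
      congrFun (partialDeriv_etaQuad hη k) u]
    ring

/-! ### Explicit primitives from the functions `H^j`. -/

section Converse

variable {H : (Fin N → ℝ) → Fin N → ℝ}

theorem inInvolution_quad_coord (hU : IsOpen U) (hη : η.IsSymm) (hΦ : B.IsLiouvilleFunction Φ)
    (hH : ∀ j, ContDiffOn ℝ ∞ (fun u => H u j) U)
    (h : ∀ u ∈ U, ∀ k j, ∑ s, η k s * Φ u s j = partialDeriv k (fun v => H v j) u)
    (j : Fin N) : B.InInvolution (fun J => etaQuad η (J 0)) (fun J => J 0 j) := by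
  refine (B.inInvolution_comp_zero_iff hU (contDiff_etaQuad η) (contDiff_coord j)).2
    ⟨fun v => v j, fun u => 2 * ((∑ i, etaForm η i u * Φ u i j) - H u j),
      (contDiff_coord j).contDiffOn, contDiffOn_const.mul ((hΦ.contDiffOn_contract j).sub (hH j)),
      fun u hu k => ⟨rfl, ?_⟩⟩
  have d1 := (hΦ.contDiffOn_contract (η := η) j).differentiableAt_of_isOpen hU hu
  have d2 := (hH j).differentiableAt_of_isOpen hU hu
  have d3 : DifferentiableAt ℝ (fun u => (∑ i, etaForm η i u * Φ u i j) - H u j) u := d1.sub d2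
  rw [hydroCoeff_quad_coord B hη, partialDeriv_const_mul k 2 d3, partialDeriv_sub k d1 d2, hΦ.partialDeriv_contract hU hη hu, h u hu]
  ring

/-- The coefficients of the bracket applied to the gradient of `η_{ij} u^i u^j`. -/
theorem sum_g_mul_add_b_mul (hU : IsOpen U) (hη : η.IsSymm) (hΦ : B.IsLiouvilleFunction Φ)
    (h : ∀ u ∈ U, ∀ k j, ∑ s, η k s * Φ u s j = partialDeriv k (fun v => H v j) u)
    {u : Fin N → ℝ} (hu : u ∈ U) (i k : Fin N) :
    ∑ j, (B.g u i j * η j k + B.b u i j k * etaForm η j u) =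
      partialDeriv k (fun v => ∑ j, Φ v i j * etaForm η j v) u +
        partialDeriv k (fun v => H v i) u - B.K * u i * etaForm η k u -
        B.K * (if i = k then 1 else 0) * etaQuad η u := by
  have dΦ := fun j => (hΦ.smooth i j).differentiableAt_of_isOpen hU hu
  have dη : ∀ i, DifferentiableAt ℝ (etaForm η i) u := fun i =>
    (contDiff_etaForm η i).differentiable (by simp) u
  have dm : ∀ j ∈ Finset.univ, DifferentiableAt ℝ (fun v => Φ v i j * etaForm η j v) u :=
    fun j _ => (dΦ j).mul (dη j)
  have h1 : ∀ j, partialDeriv k (fun v => Φ v i j * etaForm η j v) u =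
      (B.b u i j k + B.K * (if i = k then 1 else 0) * u j) * etaForm η j u + Φ u i j * η j k := by
    intro j
    rw [partialDeriv_mul k (dΦ j) (dη j), partialDeriv_etaForm, hΦ.partialDeriv_eq hu]
  rw [partialDeriv_sum k _ dm, ← h u hu]
  simp only [h1, etaQuad, Finset.mul_sum]
  rw [show B.K * u i * etaForm η k u = ∑ j, B.K * u i * (η k j * u j) by
    rw [etaForm, Finset.mul_sum]]
  rw [← Finset.sum_add_distrib, ← Finset.sum_sub_distrib, ← Finset.sum_sub_distrib]
  refine Finset.sum_congr rfl fun j _ => ?_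
  rw [hΦ.g_eq u hu, hη.apply k j]
  ring

theorem contDiffOn_sum_mul_etaForm (hΦ : B.IsLiouvilleFunction Φ) (i : Fin N) :
    ContDiffOn ℝ ∞ (fun v => ∑ j, Φ v i j * etaForm η j v) U :=
  ContDiffOn.sum fun j _ => (hΦ.smooth i j).mul (contDiff_etaForm η j).contDiffOn

theorem inInvolution_coord_quad (hU : IsOpen U) (hη : η.IsSymm) (hΦ : B.IsLiouvilleFunction Φ)
    (hH : ∀ j, ContDiffOn ℝ ∞ (fun u => H u j) U)
    (h : ∀ u ∈ U, ∀ k j, ∑ s, η k s * Φ u s j = partialDeriv k (fun v => H v j) u)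
    (i : Fin N) : B.InInvolution (fun J => J 0 i) (fun J => etaQuad η (J 0)) := by
  have cM := contDiffOn_sum_mul_etaForm (η := η) hΦ i
  have cQ : ContDiffOn ℝ ∞ (fun u => u i * etaQuad η u) U :=
    (contDiff_coord i).contDiffOn.mul (contDiff_etaQuad η).contDiffOn
  have cMH : ContDiffOn ℝ ∞ (fun u => 2 * ((∑ j, Φ u i j * etaForm η j u) + H u i)) U :=
    contDiffOn_const.mul (cM.add (hH i))
  have cMH' : ContDiffOn ℝ ∞ (fun u => (∑ j, Φ u i j * etaForm η j u) + H u i) U :=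
    cM.add (hH i)
  refine (B.inInvolution_comp_zero_iff hU (contDiff_coord i) (contDiff_etaQuad η)).2
    -- The nonlocal term cancels half of the `δ^i_k` contribution of `sum_g_mul_add_b_mul`; what
    -- remains is the gradient of `K u^i η_{rs} u^r u^s`.
    ⟨etaQuad η, fun u => 2 * ((∑ j, Φ u i j * etaForm η j u) + H u i) -
      B.K * (u i * etaQuad η u), (contDiff_etaQuad η).contDiffOn,
      cMH.sub (contDiffOn_const.mul cQ), fun u hu k => ⟨rfl, ?_⟩⟩
  have dM := cM.differentiableAt_of_isOpen hU hu
  have dH := (hH i).differentiableAt_of_isOpen hU hu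
  have dQ := cQ.differentiableAt_of_isOpen hU hu
  rw [hydroCoeff_coord_quad B hη, sum_g_mul_add_b_mul hU hη hΦ h hu,
    partialDeriv_sub k (cMH.differentiableAt_of_isOpen hU hu) (dQ.const_mul _),
    partialDeriv_const_mul k _ (cMH'.differentiableAt_of_isOpen hU hu),
    partialDeriv_add k dM dH, partialDeriv_const_mul k _ dQ,
    partialDeriv_mul k (by fun_prop) ((contDiff_etaQuad η).differentiable (by simp) u),
    partialDeriv_coord, congrFun (partialDeriv_etaQuad hη k) u]
  ring

theorem inInvolution_quad_quad (hU : IsOpen U) (hη : η.IsSymm) (hΦ : B.IsLiouvilleFunction Φ)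
    (h : ∀ u ∈ U, ∀ k j, ∑ s, η k s * Φ u s j = partialDeriv k (fun v => H v j) u) :
    B.InInvolution (fun J => etaQuad η (J 0)) (fun J => etaQuad η (J 0)) := by
  have cη := fun i => (contDiff_etaForm η i).contDiffOn (s := U)
  have cM := contDiffOn_sum_mul_etaForm (η := η) hΦ
  have cm : ∀ i, ContDiffOn ℝ ∞
      (fun u => etaForm η i u * ∑ j, Φ u i j * etaForm η j u) U := fun i => (cη i).mul (cM i)
  have cP : ContDiffOn ℝ ∞ (fun u => ∑ i, etaForm η i u * ∑ j, Φ u i j * etaForm η j u) U :=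
    ContDiffOn.sum fun i _ => cm i
  have cQ : ContDiffOn ℝ ∞ (fun u => etaQuad η u * etaQuad η u) U :=
    (contDiff_etaQuad η).contDiffOn.mul (contDiff_etaQuad η).contDiffOn
  refine (B.inInvolution_comp_zero_iff hU (contDiff_etaQuad η) (contDiff_etaQuad η)).2
    -- With `Q` the quadratic form and `q_k = η_{ks} u^s`, the `K` terms total `(-4 - 4 + 2) K q_k Q
    -- = -6 K q_k Q`, and `∂_k (Q^2) = 4 q_k Q`; hence `3 / 2`.
    ⟨etaQuad η, fun u => 4 * (∑ i, etaForm η i u * ∑ j, Φ u i j * etaForm η j u) -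
      (3 / 2 * B.K) * (etaQuad η u * etaQuad η u), (contDiff_etaQuad η).contDiffOn,
      (contDiffOn_const.mul cP).sub (contDiffOn_const.mul cQ), fun u hu k => ⟨rfl, ?_⟩⟩
  have dQ := (contDiff_etaQuad η).differentiable (by simp) u
  have dη := fun i => (contDiff_etaForm η i).differentiable (by simp) u
  have dM := fun i => (cM i).differentiableAt_of_isOpen hU hu
  have dP := cP.differentiableAt_of_isOpen hU hu
  have dQQ := cQ.differentiableAt_of_isOpen hU hu
  have h1 : ∀ i, partialDeriv k (fun u => etaForm η i u * ∑ j, Φ u i j * etaForm η j u) u =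
      η i k * (∑ j, Φ u i j * etaForm η j u) +
        etaForm η i u * partialDeriv k (fun u => ∑ j, Φ u i j * etaForm η j u) u := fun i => by
    rw [partialDeriv_mul k (dη i) (dM i), partialDeriv_etaForm]
  -- The gradient condition turns the term with differentiated `q_i` into the `H` term of the
  -- bracket, so `H` drops out of the primitive.
  have h2 : ∑ i, η i k * (∑ j, Φ u i j * etaForm η j u) =
      ∑ j, etaForm η j u * partialDeriv k (fun v => H v j) u := by
    simp only [← h u hu, Finset.mul_sum]
    rw [Finset.sum_comm]
    refine Finset.sum_congr rfl fun j _ => Finset.sum_congr rfl fun i _ => ?_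
    rw [← hη.apply i k]
    ring
  have h3 : ∑ i, etaForm η i u * (B.K * (if i = k then 1 else 0) * etaQuad η u) =
      B.K * etaForm η k u * etaQuad η u := by
    simp
    ring
  have h4 : ∑ i, etaForm η i u * (B.K * u i * etaForm η k u) =
      B.K * etaForm η k u * etaQuad η u := by
    simp only [etaQuad, Finset.mul_sum]
    exact Finset.sum_congr rfl fun i _ => by ring
  rw [hydroCoeff_quad_quad B hη, partialDeriv_sub k (dP.const_mul _) (dQQ.const_mul _),
    partialDeriv_const_mul k _ dP, partialDeriv_const_mul k _ dQQ, partialDeriv_mul k dQ dQ,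
    partialDeriv_sum k _ fun i _ => (cm i).differentiableAt_of_isOpen hU hu,
    congrFun (partialDeriv_etaQuad hη k) u]
  simp only [sum_g_mul_add_b_mul hU hη hΦ h hu, h1, mul_add, mul_sub, Finset.sum_add_distrib,
    Finset.sum_sub_distrib, h2, h3, h4]
  ring

end Converse

theorem isSpecialLiouvilleWith_iff (hU : IsOpen U) (hB : B.IsPoisson) (hη : η.IsSymm) :
    B.IsSpecialLiouvilleWith η ↔
      B.IsLiouville ∧ ∃ Φ, B.IsLiouvilleFunction Φ ∧ IsSpecialFor U η Φ := by
  constructor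
  · intro h
    have hL : B.IsLiouville := fun i j => h (some i) (some j)
    obtain ⟨Φ, hΦ⟩ := hL.exists_isLiouvilleFunction hU hB
    exact ⟨hL, Φ, hΦ, hΦ.isSpecialFor hU hη h⟩
  · rintro ⟨hL, Φ, hΦ, H, hH, h⟩ (_ | i) (_ | j)
    · rw [specialDensity_none]
      exact inInvolution_quad_quad hU hη hΦ h
    · rw [specialDensity_none]
      exact inInvolution_quad_coord hU hη hΦ hH h j
    · rw [specialDensity_none]
      exact inInvolution_coord_quad hU hη hΦ hH h i
    · exact hL i j

end NonlocalBracket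

end

theorem mainTheorem6 (N : ℕ) (U : Set (Fin N → ℝ)) (hU : IsOpen U)
    (B : NonlocalBracket N U) (hB : B.IsPoisson) :
    (∀ η : Matrix (Fin N) (Fin N) ℝ, η ≠ 0 → η.IsSymm →
      (B.IsSpecialLiouvilleWith η ↔
        B.IsLiouville ∧ ∃ Φ, B.IsLiouvilleFunction Φ ∧ IsSpecialFor U η Φ)) ∧
    (B.IsSpecialLiouville ↔
      B.IsLiouville ∧ ∃ Φ, B.IsLiouvilleFunction Φ ∧
        ∃ η : Matrix (Fin N) (Fin N) ℝ, η ≠ 0 ∧ η.IsSymm ∧ IsSpecialFor U η Φ) := by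
  refine ⟨fun η _ hη => NonlocalBracket.isSpecialLiouvilleWith_iff hU hB hη, ?_⟩
  constructor
  · rintro ⟨η, h0, hη, h⟩
    obtain ⟨hL, Φ, hΦ, hS⟩ := (NonlocalBracket.isSpecialLiouvilleWith_iff hU hB hη).1 h
    exact ⟨hL, Φ, hΦ, η, h0, hη, hS⟩
  · rintro ⟨hL, Φ, hΦ, η, h0, hη, hS⟩
    exact ⟨η, h0, hη, (NonlocalBracket.isSpecialLiouvilleWith_iff hU hB hη).2 ⟨hL, Φ, hΦ, hS⟩⟩
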